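/- **Setting.** Fix $0<\sigma_\ell<\sigma_u$. For $f:[l,u]\to\mathbb R$ let $\|f\|_{(2)}=\max(\sup|f|,\sup|f'|)+\sup_{x\ne y}|f'(x)-f'(y)|/|x-y|$ (over the interior of $[l,u]$), and let $C_A^2([l,u])$ be the continuous functions, differentiable in the interior, with $\|f\|_{(2)}\le A$. Let $\|f\|_\infty=\sup_{x\in[0,1]}|f(x)|$. *Model.* The known standard errors are $\sigma_i=\sigma(x_i)\in(\sigma_\ell,\sigma_u)$ with fixed design points $x_1,\dots,x_n\in[0,1]$, where $\sigma(x)=10^{a+bx}$, $b>0$, maps $[0,1]$ into $[\sigma_\ell,\sigma_u]$ (so $x$ is a translated and scaled $\log_{10}\sigma$). The pairs $(\theta_i,Y_i)$ are independent over $i$, $\theta_i$ has the law of $m_0(\sigma_i)+s_0(\sigma_i)\tau$ with $\tau\sim G_0$, and $Y_i\mid\theta_i\sim N(\theta_i,\sigma_i^2)$. $G_0$ has mean $0$, variance $1$ and $(E|\tau|^p)^{1/p}\le A_0p^{1/\alpha}$ for all $p\ge1$, with $\alpha\in(0,2]$. Moreover $m_0,s_0\in C^2_{A_1}([\sigma_\ell,\sigma_u])$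 and $s_0(\cdot)\in(s_\ell,s_u)$ with $s_\ell>0$. Write $m_0(x)=m_0(\sigma(x))$, $s_0(x)=s_0(\sigma(x))$ for $x\in[0,1]$. *Local linear regression.* For a kernel $K$ and bandwidth $h$ let $u(z)=(1,z)'$, $B_{nx}(h)=\frac1{nh}\sum_iK(\frac{x_i-x}h)u(\frac{x_i-x}h)u(\frac{x_i-x}h)'$, $\ell_i(x,h)=\frac1{nh}u(0)'B_{nx}(h)^{-1}u(\frac{x_i-x}h)K(\frac{x_i-x}h)$ (taken to be $0$ if $B_{nx}(h)$ is singular), and $p_n(h)=\frac1n\sum_{j}\big(\sum_i\ell_i(x_j,h)^2\big)^{-1}$ (with the convention $0^{-1}=0$). For $C_h>1$ let $H_n=[C_h^{-1}n^{-1/5}\vee\frac1{2n},\,C_hn^{-1/5}]$. *Estimators.* Let $\hat h_m,\hat h_s$ be arbitrary data-driven bandwidths, each projected to $[C_h^{-1}n^{-1/5},C_hn^{-1/5}]$. Let $\hat m$ be a $\|\cdot\|_\infty$-projection of $\sum_i\ell_i(\cdot,\hat h_m)Y_i$ on $C^2_{A_3}([0,1])$. Put $\hat R_i^2=(Y_i-\hat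 m(x_i))^2$, $\hat v(x)=\sum_i\ell_i(x,\hat h_s)\hat R_i^2$, $p_n=p_n(\hat h_s)$ and $\hat s_{\rm raw}(x)=\sqrt{\hat v(x)-\sigma^2(x)}\vee\sqrt{\frac2{p_n+2}\hat v(x)}$ (the root of a negative number being $0$). Let $\hat s$ be a $\|\cdot\|_\infty$-projection of $\hat s_{\rm raw}$ on the set of $s\in C^2_{A_3}([0,1])$ with $s\ge0$ and $s^2\ge\frac2{p_n+2}\min_i\sigma_i^2$ on $[0,1]$. *Design and kernel.* With constants $n_0\in\mathbb N$, $\lambda_0,a_0,K_0,c_1,c_2,C_K,V_K>0$: (i) for $n\ge n_0$, all $x\in[0,1]$ and $h\in H_n$, $\lambda_{\min}(B_{nx}(h))\ge\lambda_0$; (ii) $\frac1n\#\{i:x_i\in I\}\le a_0(|I|\vee\frac1n)$ for every interval $I\subset[0,1]$; (iii) $K=0$ off $[-1,1]$ and $|K|\le K_0$; (iv) for $n\ge n_0$ and $h\in H_n$, $c_1n^{4/5}\le p_n(h)\le c_2n^{4/5}$; (v) for all $n\ge1$, $k=1,2$, all finitely supported probability measures $Q$ on $\mathbb R$ and $0<\epsilon\le1$,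 the class $\{y\mapsto(\frac{y-x}h)^{k-1}K(\frac{y-x}h):x\in[0,1],h\in H_n\}$ has $L_2(Q)$ covering number $N(\epsilon)\le C_K\epsilon^{-V_K}$. **Theorem.** There is $c_3>0$ depending only on $\sigma_\ell,\sigma_u$ such that for every $A_3\ge c_3A_1$ the following holds. There are $C,c>0$, depending only on $(\sigma_\ell,\sigma_u,s_\ell,s_u,A_0,A_1,A_3,\alpha)$ and $(K,C_h,n_0,\lambda_0,a_0,K_0,c_1,c_2,C_K,V_K)$, such that for all $n\ge7$ and whenever the estimators satisfy the description above almost surely: 1. $P\big(\hat m,\hat s\in C^2_{A_3}([0,1])\big)=1$; 2. for all $t>1$, $P\Big(\max(\|\hat m-m_0\|_\infty,\|\hat s-s_0\|_\infty)\ge C\,t\,n^{-2/5}(\log n)^{1+2/\alpha}\Big)\le\dfrac1{n^{10}t^2}$; 3. $P\big(\hat s(x)\ge c/n\text{ for all }x\in[0,1]\big)=1$. -/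

import Mathlib

open MeasureTheory ProbabilityTheory Set
open scoped ENNReal Matrix

noncomputable section

/-! ### Sup-norm distance and the Hölder class of order two -/

/-- `‖f - g‖_∞` over `[0,1]`, with values in `[0,∞]`. -/
def supDist (f g : ℝ → ℝ) : ℝ≥0∞ :=
  ⨆ x ∈ Icc (0 : ℝ) 1, ‖f x - g x‖ₑ

/-- The Hölder norm of order `p = 2` on `[l,u]`. The largest integer strictly below `2` is `1`, so
the norm is the maximum of the sup norms of `f` and `f'` plus the Lipschitz constant of `f'`, all
taken over the interior. -/
def holderNorm2 (l u : ℝ) (f : ℝ → ℝ) : ℝ≥0∞ :=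
  max (⨆ x ∈ Ioo l u, ‖f x‖ₑ) (⨆ x ∈ Ioo l u, ‖deriv f x‖ₑ) +
    ⨆ x ∈ Ioo l u, ⨆ y ∈ Ioo l u, ‖deriv f x - deriv f y‖ₑ / ‖x - y‖ₑ

/-- The Hölder class `C_A^2([l,u])`; only the values of `f` on `[l,u]` matter. -/
def HolderClass2 (A l u : ℝ) : Set (ℝ → ℝ) :=
  {f | ContinuousOn f (Icc l u) ∧ DifferentiableOn ℝ f (Ioo l u) ∧
    holderNorm2 l u f ≤ ENNReal.ofReal A}

/-- `g` is a sup-norm projection of `f` on the class `S`: `g ∈ argmin_{k ∈ S} ‖k - f‖_∞`. -/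
def IsSupProj (S : Set (ℝ → ℝ)) (f g : ℝ → ℝ) : Prop :=
  g ∈ S ∧ ∀ k ∈ S, supDist g f ≤ supDist k f

/-! ### Local linear regression -/

/-- `u(z) = [1, z]'`. -/
def uVec (z : ℝ) : Fin 2 → ℝ := ![1, z]

/-- The matrix `B_{nx}(h) = (nh)⁻¹ ∑ᵢ K((xᵢ-x)/h) u((xᵢ-x)/h) u((xᵢ-x)/h)'`. -/
def llrMatrix {n : ℕ} (K : ℝ → ℝ) (X : Fin n → ℝ) (h x : ℝ) : Matrix (Fin 2) (Fin 2) ℝ :=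
  (1 / ((n : ℝ) * h)) • ∑ i, K ((X i - x) / h) •
    Matrix.vecMulVec (uVec ((X i - x) / h)) (uVec ((X i - x) / h))

/-- The local linear regression weights
`ℓᵢ(x,h) = (nh)⁻¹ u(0)' B_{nx}(h)⁻¹ u((xᵢ-x)/h) K((xᵢ-x)/h)`
(equal to `0` by convention where `B_{nx}(h)` is singular). -/
def llrWeight {n : ℕ} (K : ℝ → ℝ) (X : Fin n → ℝ) (h : ℝ) (i : Fin n) (x : ℝ) : ℝ :=
  1 / ((n : ℝ) * h) * (uVec 0 ⬝ᵥ ((llrMatrix K X h x)⁻¹ *ᵥ uVec ((X i - x) / h))) *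
    K ((X i - x) / h)

/-- The local linear regression of the responses `y` on the design points `X`. -/
def localLinear {n : ℕ} (K : ℝ → ℝ) (X : Fin n → ℝ) (h : ℝ) (y : Fin n → ℝ) (x : ℝ) : ℝ :=
  ∑ i, llrWeight K X h i x * y i

/-- The effective sample size: the average, over the evaluation points `x₁, …, xₙ`, of
`1 / ∑ᵢ ℓᵢ(xⱼ,h)²`. -/
def effSampleSize {n : ℕ} (K : ℝ → ℝ) (X : Fin n → ℝ) (h : ℝ) : ℝ :=
  1 / (n : ℝ) * ∑ j, 1 / ∑ i, llrWeight K X h i (X j) ^ 2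

/-- The bandwidth set `H_n = [C_h⁻¹ n^{-1/5} ∨ 1/(2n), C_h n^{-1/5}]`. -/
def bandwidthSet (Ch : ℝ) (n : ℕ) : Set ℝ :=
  Icc (max (Ch⁻¹ * (n : ℝ) ^ (-(1 / 5) : ℝ)) (1 / (2 * (n : ℝ)))) (Ch * (n : ℝ) ^ (-(1 / 5) : ℝ))

/-- Projection of a bandwidth to `[C_h⁻¹ n^{-1/5}, C_h n^{-1/5}]`. -/
def projBandwidth (Ch : ℝ) (n : ℕ) (h : ℝ) : ℝ :=
  min (max h (Ch⁻¹ * (n : ℝ) ^ (-(1 / 5) : ℝ))) (Ch * (n : ℝ) ^ (-(1 / 5) : ℝ))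

/-- The standard error as a function of the regressor, `σ(x) = 10^{a + b x}`: the regressor `x` is
`log₁₀ σ`, translated and scaled to take values in `[0,1]`. -/
def sigmaFn (a b x : ℝ) : ℝ := (10 : ℝ) ^ (a + b * x)

/-- The lower bound `2 / (p_n + 2) · minᵢ σᵢ²`. -/
def varFloor {n : ℕ} (K : ℝ → ℝ) (X : Fin n → ℝ) (h a b : ℝ) : ℝ :=
  2 / (effSampleSize K X h + 2) * ⨅ i, sigmaFn a b (X i) ^ 2

/-- The truncated estimate `√(v̂(x) - σ²(x)) ∨ √(2 / (p_n + 2) · v̂(x))`, where `v̂` is the local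
linear regression of the squared residuals `R2`. The root of a negative number is `0`. -/
def sRaw {n : ℕ} (K : ℝ → ℝ) (X : Fin n → ℝ) (h a b : ℝ) (R2 : Fin n → ℝ) (x : ℝ) : ℝ :=
  max (Real.sqrt (localLinear K X h R2 x - sigmaFn a b x ^ 2))
    (Real.sqrt (2 / (effSampleSize K X h + 2) * localLinear K X h R2 x))

/-- `(mHat, sHat)` is an output of the estimation procedure on the data `(y, X)` when the bandwidth
selectors return `hm` (for the mean) and `hs` (for the variance): both are projected; the local
linear estimate of the mean is projected to `C_{A₃}^2([0,1])`; the squared residuals are regressed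
on the design points; the outcome is truncated and then projected to the nonnegative functions of
`C_{A₃}^2([0,1])` whose square is at least `2 / (p_n + 2) · minᵢ σᵢ²`. -/
def IsLLREstimate {n : ℕ} (K : ℝ → ℝ) (Ch A₃ a b : ℝ) (X y : Fin n → ℝ) (hm hs : ℝ)
    (mHat sHat : ℝ → ℝ) : Prop :=
  IsSupProj (HolderClass2 A₃ 0 1) (localLinear K X (projBandwidth Ch n hm) y) mHat ∧
  IsSupProj
    {s | s ∈ HolderClass2 A₃ 0 1 ∧
      ∀ x ∈ Icc (0 : ℝ) 1, 0 ≤ s x ∧ varFloor K X (projBandwidth Ch n hs) a b ≤ s x ^ 2}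
    (sRaw K X (projBandwidth Ch n hs) a b (fun i => (y i - mHat (X i)) ^ 2)) sHat

/-! ### Assumptions on the design and the kernel -/

/-- Regularity of the design points `X = (x₁, …, xₙ)` in `[0,1]`, for one sample size `n`; the
first and last requirements are only made for `n ≥ n₀`. -/
def RegularDesign {n : ℕ} (K : ℝ → ℝ) (Ch : ℝ) (n₀ : ℕ) (lam₀ a₀ c₁ c₂ : ℝ) (X : Fin n → ℝ) :
    Prop :=
  (∀ i, X i ∈ Icc (0 : ℝ) 1) ∧
  -- the smallest eigenvalue of `B_{nx}(h)` is at least `lam₀`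
  (n₀ ≤ n → ∀ x ∈ Icc (0 : ℝ) 1, ∀ h ∈ bandwidthSet Ch n,
    ∀ μ ∈ spectrum ℝ (llrMatrix K X h x), lam₀ ≤ μ) ∧
  (∀ I : Set ℝ, I ⊆ Icc 0 1 → I.OrdConnected →
    1 / (n : ℝ) * ({i | X i ∈ I} : Set (Fin n)).ncard ≤
      a₀ * max (volume.real I) (1 / (n : ℝ))) ∧
  (n₀ ≤ n → ∀ h ∈ bandwidthSet Ch n,
    c₁ * (n : ℝ) ^ (4 / 5 : ℝ) ≤ effSampleSize K X h ∧
      effSampleSize K X h ≤ c₂ * (n : ℝ) ^ (4 / 5 : ℝ))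

/-- The covering number `N(ε, F, L₂(Q))`: the least number of `L₂(Q)`-balls of radius `ε` that
cover `F`. -/
def coveringNumberL2 (Q : Measure ℝ) (F : Set (ℝ → ℝ)) (ε : ℝ) : ℕ∞ :=
  ⨅ (T : Finset (ℝ → ℝ))
    (_ : ∀ f ∈ F, ∃ g ∈ T, eLpNorm (fun y => f y - g y) 2 Q < ENNReal.ofReal ε), (T.card : ℕ∞)

/-- The class `F_k = {y ↦ ((y-x)/h)^{k-1} K((y-x)/h) : x ∈ [0,1], h ∈ H_n}`. -/
def kernelClass (K : ℝ → ℝ) (Ch : ℝ) (n k : ℕ) : Set (ℝ → ℝ) :=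
  {f | ∃ x ∈ Icc (0 : ℝ) 1, ∃ h ∈ bandwidthSet Ch n,
    f = fun y => ((y - x) / h) ^ (k - 1) * K ((y - x) / h)}

/-- The kernel is supported on `[-1,1]`, is bounded by `K₀`, and the classes `F_1`, `F_2` have
polynomial covering numbers, uniformly over finitely supported probability measures. -/
def RegularKernel (K : ℝ → ℝ) (Ch K₀ CK VK : ℝ) : Prop :=
  (∀ z, z ∉ Icc (-1 : ℝ) 1 → K z = 0) ∧ (∀ z, |K z| ≤ K₀) ∧
  ∀ n : ℕ, 1 ≤ n → ∀ k : ℕ, k = 1 ∨ k = 2 →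
    ∀ Q : Measure ℝ, IsProbabilityMeasure Q → (∃ S : Finset ℝ, Q (S : Set ℝ)ᶜ = 0) →
      ∀ ε : ℝ, 0 < ε → ε ≤ 1 →
        (coveringNumberL2 Q (kernelClass K Ch n k) ε : ℝ≥0∞) ≤
          ENNReal.ofReal (CK * (1 / ε) ^ VK)

/-! ### The sampling model -/

/-- `G₀` has mean zero, variance one and `(E|τ|^p)^{1/p} ≤ A₀ p^{1/α}` for all real `p ≥ 1`. -/
def MomentControl (G₀ : Measure ℝ) (A₀ α : ℝ) : Prop :=
  ∫ τ, τ ∂G₀ = 0 ∧ Var[fun τ => τ; G₀] = 1 ∧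
  ∀ p : ℝ, 1 ≤ p →
    eLpNorm (fun τ : ℝ => τ) (ENNReal.ofReal p) G₀ ≤ ENNReal.ofReal (A₀ * p ^ (1 / α))

/-- The location-scale model with known standard errors `σᵢ`: the pairs `(θᵢ, Yᵢ)` are independent
over `i`, `θᵢ` is distributed as `m₀(σᵢ) + s₀(σᵢ) τ` with `τ ∼ G₀`, and
`Yᵢ ∣ θᵢ ∼ N(θᵢ, σᵢ²)`, i.e. `Yᵢ - θᵢ` is independent of `θᵢ` with law `N(0, σᵢ²)`. -/
def LocationScaleSample {Ω : Type*} [MeasurableSpace Ω] (P : Measure Ω) {n : ℕ}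
    (G₀ : Measure ℝ) (m₀ s₀ : ℝ → ℝ) (σ : Fin n → ℝ) (θ Y : Fin n → Ω → ℝ) : Prop :=
  (∀ i, Measurable (θ i)) ∧ (∀ i, Measurable (Y i)) ∧
  iIndepFun (fun i ω => (θ i ω, Y i ω)) P ∧
  ∀ i, P.map (θ i) = G₀.map (fun τ => m₀ (σ i) + s₀ (σ i) * τ) ∧
    IndepFun (θ i) (fun ω => Y i ω - θ i ω) P ∧
    P.map (fun ω => Y i ω - θ i ω) = gaussianReal 0 (Real.toNNReal (σ i ^ 2))

end

/-!
The proof compares each projected estimate with its target: a sup-norm projection is at most twice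
as far from a member of the class as the function that was projected (`IsSupProj.abs_sub_le`), and
`m₀ ∘ σ`, `s₀ ∘ σ` belong to the class because composition with `σ` enlarges the Hölder norm by a
factor that depends on `σ_ℓ`, `σ_u` only (`HolderClass2.comp_sigmaFn`). The sup-norm error of the
local linear estimates is then split into bias and noise.

* Bias. The local linear weights reproduce constants, annihilate linear terms, and have bounded
  `ℓ¹` norm, so the bias is of order `h² ≍ n^{-2/5}` (`abs_localLinear_sub_le`).
* Noise. The weights are bounded combinations of members of the two kernel classes, so it suffices
  to bound `∑ f(xᵢ) ξᵢ` over these classes by `n^{2/5}` up to logarithms, where `ξᵢ` are the errors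
  `εᵢ = Yᵢ - m₀(σᵢ)` or the centred `εᵢ²`. With respect to the empirical measure of the design
  points, the classes have nets of polynomial size and mesh `n⁻²` (`exists_kernelClass_net`). Since
  the rate allows for logarithmic factors, no chaining is needed: the errors are truncated at a
  multiple of `(log n)^{1/α}`, and a union bound over the net is combined with Hoeffding's
  inequality (`measure_exists_weighted_sum_gt_le`).
* Residuals. Squared residuals differ from squared errors by `2 εᵢ δᵢ + δᵢ²`, with `δᵢ` bounded by
  the error of the mean estimate. Bounding `|εᵢ|` by its maximum costs one more factor
  `(log n)^{1/α}`, within the rate (`RegularDesign.abs_variance_sub_le`). As `s₀` is bounded below,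
  the error of the variance passes to the root.

The resulting bound (`RegularDesign.estimation_error_le`) holds off an event of probability at most
`n⁻¹¹` (`LocationScaleSample.measure_not_regular_le`). The dependence on `t` comes for free: the
errors are bounded by `A₁ + A₃`, so the event in question is null unless `t ≤ n^{2/5}`, and then
`n⁻¹¹ ≤ 1 / (n¹⁰ t²)`. The same bound disposes of small `n`.

Finally, the scale estimate is at least of order `1 / n` because the effective sample size never
exceeds `n`, by the Cauchy-Schwarz inequality (`effSampleSize_le`).
-/

/-! ### Hölder classes of order two -/

theorem HolderClass2.abs_le_of_mem_Ioo {A l u : ℝ} {f : ℝ → ℝ} (hA : 0 ≤ A)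
    (hf : f ∈ HolderClass2 A l u) {x : ℝ} (hx : x ∈ Ioo l u) : |f x| ≤ A := by
  have h : ‖f x‖ₑ ≤ ENNReal.ofReal A :=
    (((le_iSup₂ (f := fun x (_ : x ∈ Ioo l u) => ‖f x‖ₑ) x hx).trans (le_max_left _ _)).trans
      le_self_add).trans hf.2.2
  rwa [Real.enorm_eq_ofReal_abs, ENNReal.ofReal_le_ofReal_iff hA] at h

theorem HolderClass2.abs_deriv_le {A l u : ℝ} {f : ℝ → ℝ} (hA : 0 ≤ A)
    (hf : f ∈ HolderClass2 A l u) {x : ℝ} (hx : x ∈ Ioo l u) : |deriv f x| ≤ A := by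
  have h : ‖deriv f x‖ₑ ≤ ENNReal.ofReal A :=
    (((le_iSup₂ (f := fun x (_ : x ∈ Ioo l u) => ‖deriv f x‖ₑ) x hx).trans
      (le_max_right _ _)).trans le_self_add).trans hf.2.2
  rwa [Real.enorm_eq_ofReal_abs, ENNReal.ofReal_le_ofReal_iff hA] at h

theorem HolderClass2.abs_deriv_sub_le {A l u : ℝ} {f : ℝ → ℝ} (hA : 0 ≤ A)
    (hf : f ∈ HolderClass2 A l u) {x y : ℝ} (hx : x ∈ Ioo l u) (hy : y ∈ Ioo l u) :
    |deriv f x - deriv f y| ≤ A * |x - y| := by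
  rcases eq_or_ne x y with rfl | hxy
  · simp
  have h : ‖deriv f x - deriv f y‖ₑ / ‖x - y‖ₑ ≤ ENNReal.ofReal A :=
    ((le_iSup₂_of_le (f := fun x (_ : x ∈ Ioo l u) =>
        ⨆ y ∈ Ioo l u, ‖deriv f x - deriv f y‖ₑ / ‖x - y‖ₑ) x hx
      (le_iSup₂ (f := fun y (_ : y ∈ Ioo l u) => ‖deriv f x - deriv f y‖ₑ / ‖x - y‖ₑ) y hy)).trans
      le_add_self).trans hf.2.2
  have h0 : ‖x - y‖ₑ ≠ 0 := by simpa [sub_eq_zero] using hxy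
  rw [ENNReal.div_le_iff h0 enorm_ne_top, Real.enorm_eq_ofReal_abs, Real.enorm_eq_ofReal_abs,
    ← ENNReal.ofReal_mul hA, ENNReal.ofReal_le_ofReal_iff (by positivity)] at h
  exact h

theorem mem_holderClass2_of_bounds {A l u B D : ℝ} {f : ℝ → ℝ} (hB : 0 ≤ B) (hD : 0 ≤ D)
    (hc : ContinuousOn f (Icc l u)) (hd : DifferentiableOn ℝ f (Ioo l u))
    (h0 : ∀ x ∈ Ioo l u, |f x| ≤ B) (h1 : ∀ x ∈ Ioo l u, |deriv f x| ≤ B)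
    (h2 : ∀ x ∈ Ioo l u, ∀ y ∈ Ioo l u, |deriv f x - deriv f y| ≤ D * |x - y|)
    (hA : B + D ≤ A) : f ∈ HolderClass2 A l u := by
  refine ⟨hc, hd, ?_⟩
  refine le_trans ?_ (ENNReal.ofReal_le_ofReal hA)
  rw [ENNReal.ofReal_add hB hD]
  refine add_le_add (max_le ?_ ?_) ?_
  · refine iSup₂_le fun x hx => ?_
    rw [Real.enorm_eq_ofReal_abs]
    exact ENNReal.ofReal_le_ofReal (h0 x hx)
  · refine iSup₂_le fun x hx => ?_
    rw [Real.enorm_eq_ofReal_abs]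
    exact ENNReal.ofReal_le_ofReal (h1 x hx)
  · refine iSup₂_le fun x hx => iSup₂_le fun y hy => ENNReal.div_le_of_le_mul ?_
    rw [Real.enorm_eq_ofReal_abs, Real.enorm_eq_ofReal_abs, ← ENNReal.ofReal_mul hD]
    exact ENNReal.ofReal_le_ofReal (h2 x hx y hy)

theorem HolderClass2.mono {A B l u : ℝ} (h : A ≤ B) : HolderClass2 A l u ⊆ HolderClass2 B l u :=
  fun _ hf => ⟨hf.1, hf.2.1, hf.2.2.trans (ENNReal.ofReal_le_ofReal h)⟩

theorem HolderClass2.abs_le {A l u : ℝ} {f : ℝ → ℝ} (hlu : l < u) (hA : 0 ≤ A)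
    (hf : f ∈ HolderClass2 A l u) {x : ℝ} (hx : x ∈ Icc l u) : |f x| ≤ A := by
  have hx' : x ∈ closure (Ioo l u) := by rwa [closure_Ioo hlu.ne]
  have hc : ContinuousOn f (closure (Ioo l u)) := by rw [closure_Ioo hlu.ne]; exact hf.1
  have := closure_minimal (s := f '' Ioo l u) (t := Icc (-A) A) (by
    rintro _ ⟨y, hy, rfl⟩
    exact _root_.abs_le.1 (HolderClass2.abs_le_of_mem_Ioo hA hf hy)) isClosed_Icc
  exact _root_.abs_le.2 (this (hc.image_closure (mem_image_of_mem f hx')))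

/-- Around each point `x`, a function of the Hölder class is linear up to a quadratic error. The
slope at an endpoint of the interval is the value there of a Lipschitz extension of the
derivative. -/
theorem HolderClass2.exists_taylor {A l u : ℝ} {f : ℝ → ℝ} (hA : 0 ≤ A)
    (hf : f ∈ HolderClass2 A l u) (x : ℝ) (hx : x ∈ Icc l u) :
    ∃ d : ℝ, ∀ y ∈ Icc l u, |f y - f x - d * (y - x)| ≤ A * (y - x) ^ 2 := by
  obtain ⟨g, hg, hfg⟩ := LipschitzOnWith.extend_real (f := deriv f) (s := Ioo l u) (K := A.toNNReal)
    (LipschitzOnWith.of_dist_le_mul fun x hx y hy => by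
      simpa [Real.dist_eq, Real.coe_toNNReal _ hA] using
        HolderClass2.abs_deriv_sub_le hA hf hx hy)
  have hg' : ∀ x y, |g x - g y| ≤ A * |x - y| := fun x y => by
    simpa [Real.dist_eq, Real.coe_toNNReal _ hA] using hg.dist_le_mul x y
  -- the mean value theorem between two points of the interval, in increasing order
  have key : ∀ p ∈ Icc l u, ∀ q ∈ Icc l u, p < q →
      ∃ c ∈ Ioo p q, f q - f p = g c * (q - p) := by
    intro p hp q hq hpq
    obtain ⟨c, hc, h⟩ := exists_deriv_eq_slope f hpq
      (hf.1.mono (Icc_subset_Icc hp.1 hq.2)) (hf.2.1.mono (Ioo_subset_Ioo hp.1 hq.2))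
    refine ⟨c, hc, ?_⟩
    rw [← hfg (Ioo_subset_Ioo hp.1 hq.2 hc), h, div_mul_cancel₀ _ (sub_pos.2 hpq).ne']
  refine ⟨g x, fun y hy => ?_⟩
  have fin : ∀ c, |c - x| ≤ |y - x| → f y - f x = g c * (y - x) →
      |f y - f x - g x * (y - x)| ≤ A * (y - x) ^ 2 := by
    intro c hc h
    rw [h, ← sub_mul, abs_mul, ← sq_abs (y - x), sq, ← mul_assoc]
    exact mul_le_mul_of_nonneg_right ((hg' c x).trans (mul_le_mul_of_nonneg_left hc hA))
      (abs_nonneg _)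
  rcases lt_trichotomy x y with h | rfl | h
  · obtain ⟨c, hc, e⟩ := key x hx y hy h
    refine fin c ?_ e
    rw [abs_of_pos (sub_pos.2 hc.1), abs_of_pos (sub_pos.2 h)]
    linarith [hc.2]
  · simp
  · obtain ⟨c, hc, e⟩ := key y hy x hx h
    refine fin c ?_ (by linarith)
    rw [abs_of_neg (sub_neg.2 hc.2), abs_of_neg (sub_neg.2 h)]
    linarith [hc.1]

theorem HolderClass2.abs_sub_le {A l u : ℝ} {f : ℝ → ℝ} (hA : 0 ≤ A)
    (hf : f ∈ HolderClass2 A l u) {x y : ℝ} (hx : x ∈ Icc l u) (hy : y ∈ Icc l u) :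
    |f y - f x| ≤ A * |y - x| := by
  have key : ∀ p ∈ Icc l u, ∀ q ∈ Icc l u, p < q → |f q - f p| ≤ A * |q - p| := by
    intro p hp q hq hpq
    obtain ⟨c, hc, h⟩ := exists_deriv_eq_slope f hpq
      (hf.1.mono (Icc_subset_Icc hp.1 hq.2)) (hf.2.1.mono (Ioo_subset_Ioo hp.1 hq.2))
    have : f q - f p = deriv f c * (q - p) := by
      rw [h, div_mul_cancel₀ _ (sub_pos.2 hpq).ne']
    rw [this, abs_mul]
    exact mul_le_mul_of_nonneg_right
      (HolderClass2.abs_deriv_le hA hf (Ioo_subset_Ioo hp.1 hq.2 hc)) (abs_nonneg _)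
  rcases lt_trichotomy x y with h | rfl | h
  · exact key x hx y hy h
  · simp
  · rw [abs_sub_comm, abs_sub_comm y]
    exact key y hy x hx h

/-- The square of a function of the Hölder class is linear near each point up to a quadratic
error. -/
theorem HolderClass2.exists_taylor_sq {A l u : ℝ} {f : ℝ → ℝ} (hlu : l < u) (hA : 0 ≤ A)
    (hf : f ∈ HolderClass2 A l u) (x : ℝ) (hx : x ∈ Icc l u) :
    ∃ d : ℝ, ∀ y ∈ Icc l u, |f y ^ 2 - f x ^ 2 - d * (y - x)| ≤ 3 * A ^ 2 * (y - x) ^ 2 := by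
  obtain ⟨d, hd⟩ := HolderClass2.exists_taylor hA hf x hx
  refine ⟨2 * f x * d, fun y hy => ?_⟩
  have h1 := hd y hy
  have h2 := HolderClass2.abs_sub_le hA hf hx hy
  have h3 := HolderClass2.abs_le hlu hA hf hx
  have e : f y ^ 2 - f x ^ 2 - 2 * f x * d * (y - x) =
      (f y - f x) ^ 2 + 2 * (f x * (f y - f x - d * (y - x))) := by ring
  have h4 : (f y - f x) ^ 2 ≤ A ^ 2 * (y - x) ^ 2 := by
    rw [← sq_abs (f y - f x), ← sq_abs (y - x), ← mul_pow]
    exact pow_le_pow_left₀ (abs_nonneg _) h2 2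
  have h5 : |f x * (f y - f x - d * (y - x))| ≤ A * (A * (y - x) ^ 2) := by
    rw [abs_mul]
    exact mul_le_mul h3 h1 (abs_nonneg _) hA
  rw [e]
  calc |(f y - f x) ^ 2 + 2 * (f x * (f y - f x - d * (y - x)))|
      ≤ |(f y - f x) ^ 2| + 2 * |f x * (f y - f x - d * (y - x))| := by
        refine (abs_add_le _ _).trans ?_
        rw [abs_mul 2, abs_two]
    _ ≤ A ^ 2 * (y - x) ^ 2 + 2 * (A * (A * (y - x) ^ 2)) := by
        rw [abs_of_nonneg (sq_nonneg (f y - f x))]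
        gcongr
    _ = 3 * A ^ 2 * (y - x) ^ 2 := by ring

theorem id_mem_holderClass2 {l u : ℝ} (hl : 0 < l) :
    (fun y => y) ∈ HolderClass2 (max u 1) l u := by
  refine mem_holderClass2_of_bounds (B := max u 1) (D := 0) (by positivity) le_rfl
    continuous_id.continuousOn differentiable_id.differentiableOn ?_ ?_ ?_ (by simp)
  · intro x hx
    rw [abs_of_pos (hl.trans hx.1)]
    exact hx.2.le.trans (le_max_left _ _)
  · intro x _
    simp
  · intro x _ y _
    simp

/-! ### The standard error as a function of the regressor -/

theorem sigmaFn_pos (a b x : ℝ) : 0 < sigmaFn a b x := Real.rpow_pos_of_pos (by norm_num) _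

theorem hasDerivAt_sigmaFn (a b x : ℝ) :
    HasDerivAt (sigmaFn a b) (b * Real.log 10 * sigmaFn a b x) x := by
  have h : HasDerivAt (fun x : ℝ => a + b * x) b x := by
    simpa using ((hasDerivAt_id x).const_mul b).const_add a
  have := h.const_rpow (a := 10) (by norm_num)
  refine this.congr_deriv ?_
  rw [sigmaFn]
  ring

theorem strictMono_sigmaFn {a b : ℝ} (hb : 0 < b) : StrictMono (sigmaFn a b) := by
  intro x y hxy
  exact Real.rpow_lt_rpow_of_exponent_lt (by norm_num) (by nlinarith)

/-- The growth rate of `σ` is at most `log (σ_u / σ_ℓ)`, as `σ` maps `[0,1]` into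
`[σ_ℓ,σ_u]`. -/
theorem slope_sigmaFn_le {σl σu a b : ℝ} (hσl : 0 < σl)
    (hσ : ∀ x ∈ Icc (0 : ℝ) 1, sigmaFn a b x ∈ Icc σl σu) :
    b * Real.log 10 ≤ Real.log (σu / σl) := by
  have h0 := (hσ 0 (by simp)).1
  have h1 := (hσ 1 (by simp)).2
  have e : (10 : ℝ) ^ b = sigmaFn a b 1 / sigmaFn a b 0 := by
    unfold sigmaFn
    rw [← Real.rpow_sub (by norm_num)]
    simp
  rw [← Real.log_rpow (by norm_num), e]
  refine Real.log_le_log (div_pos (sigmaFn_pos _ _ _) (sigmaFn_pos _ _ _)) ?_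
  exact div_le_div₀ ((sigmaFn_pos _ _ _).le.trans h1) h1 hσl h0

/-- The factor by which composition with `σ` may enlarge the Hölder norm. -/
noncomputable def holderFactor (σl σu : ℝ) : ℝ :=
  1 + Real.log (σu / σl) * σu + (Real.log (σu / σl) * σu) ^ 2 + Real.log (σu / σl) ^ 2 * σu

theorem one_le_holderFactor {σl σu : ℝ} (hσl : 0 < σl) (hσu : σl < σu) :
    1 ≤ holderFactor σl σu := by
  have hL : 0 ≤ Real.log (σu / σl) := Real.log_nonneg ((one_le_div hσl).2 hσu.le)
  have : 0 < σu := hσl.trans hσu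
  unfold holderFactor
  have : 0 ≤ Real.log (σu / σl) * σu + (Real.log (σu / σl) * σu) ^ 2 +
    Real.log (σu / σl) ^ 2 * σu := by positivity
  linarith

theorem HolderClass2.comp_sigmaFn {σl σu a b A : ℝ} {f : ℝ → ℝ} (hσl : 0 < σl) (hσu : σl < σu)
    (hb : 0 < b) (hσ : ∀ x ∈ Icc (0 : ℝ) 1, sigmaFn a b x ∈ Icc σl σu) (hA : 0 ≤ A)
    (hf : f ∈ HolderClass2 A σl σu) :
    (fun x => f (sigmaFn a b x)) ∈ HolderClass2 (holderFactor σl σu * A) 0 1 := by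
  have hu : 0 < σu := hσl.trans hσu
  set L := Real.log (σu / σl) with hL
  have hL0 : 0 ≤ L := Real.log_nonneg ((one_le_div hσl).2 hσu.le)
  set κ := b * Real.log 10 with hκ
  have hκ0 : 0 ≤ κ := mul_nonneg hb.le (Real.log_nonneg (by norm_num))
  have hκL : κ ≤ L := slope_sigmaFn_le hσl hσ
  have hmap : ∀ x ∈ Ioo (0 : ℝ) 1, sigmaFn a b x ∈ Ioo σl σu := fun x hx =>
    ⟨(hσ 0 (by simp)).1.trans_lt (strictMono_sigmaFn hb hx.1),
      (strictMono_sigmaFn hb hx.2).trans_le (hσ 1 (by simp)).2⟩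
  have hder : ∀ x ∈ Ioo (0 : ℝ) 1, HasDerivAt (fun x => f (sigmaFn a b x))
      (deriv f (sigmaFn a b x) * (κ * sigmaFn a b x)) x := fun x hx =>
    HasDerivAt.comp x ((hf.2.1.differentiableAt (Ioo_mem_nhds (hmap x hx).1
      (hmap x hx).2)).hasDerivAt) (hasDerivAt_sigmaFn a b x)
  have hs : ∀ x ∈ Ioo (0 : ℝ) 1, |κ * sigmaFn a b x| ≤ L * σu := fun x hx => by
    rw [abs_of_nonneg (mul_nonneg hκ0 (sigmaFn_pos _ _ _).le)]
    exact mul_le_mul hκL (hmap x hx).2.le (sigmaFn_pos _ _ _).le hL0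
  have hlip : ∀ x ∈ Ioo (0 : ℝ) 1, ∀ y ∈ Ioo (0 : ℝ) 1,
      |sigmaFn a b x - sigmaFn a b y| ≤ L * σu * |x - y| := by
    intro x hx y hy
    have := (convex_Ioo (0 : ℝ) 1).norm_image_sub_le_of_norm_deriv_le (f := sigmaFn a b)
      (C := L * σu) (fun z _ => (hasDerivAt_sigmaFn a b z).differentiableAt) (fun z hz => by
        rw [(hasDerivAt_sigmaFn a b z).deriv]
        exact hs z hz) hy hx
    exact this
  refine mem_holderClass2_of_bounds (B := A * (1 + L * σu))
    (D := A * ((L * σu) ^ 2 + L ^ 2 * σu)) (by positivity) (by positivity) ?_ ?_ ?_ ?_ ?_ ?_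
  · exact hf.1.comp (fun x _ => (hasDerivAt_sigmaFn a b x).continuousAt.continuousWithinAt) hσ
  · exact fun x hx => (hder x hx).differentiableAt.differentiableWithinAt
  · intro x hx
    refine (HolderClass2.abs_le_of_mem_Ioo hA hf (hmap x hx)).trans ?_
    exact le_mul_of_one_le_right hA (by nlinarith [mul_nonneg hL0 hu.le])
  · intro x hx
    rw [(hder x hx).deriv, abs_mul]
    calc _ ≤ A * (L * σu) := mul_le_mul (HolderClass2.abs_deriv_le hA hf (hmap x hx)) (hs x hx)
          (abs_nonneg _) hA
      _ ≤ _ := by nlinarith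
  · intro x hx y hy
    rw [(hder x hx).deriv, (hder y hy).deriv]
    have e : deriv f (sigmaFn a b x) * (κ * sigmaFn a b x) -
        deriv f (sigmaFn a b y) * (κ * sigmaFn a b y) =
        (deriv f (sigmaFn a b x) - deriv f (sigmaFn a b y)) * (κ * sigmaFn a b x) +
          deriv f (sigmaFn a b y) * (κ * (sigmaFn a b x - sigmaFn a b y)) := by ring
    have h1 : |deriv f (sigmaFn a b x) - deriv f (sigmaFn a b y)| ≤ A * (L * σu * |x - y|) :=
      (HolderClass2.abs_deriv_sub_le hA hf (hmap x hx) (hmap y hy)).trans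
        (mul_le_mul_of_nonneg_left (hlip x hx y hy) hA)
    have h2 : |κ * (sigmaFn a b x - sigmaFn a b y)| ≤ L * (L * σu * |x - y|) := by
      rw [abs_mul, abs_of_nonneg hκ0]
      exact mul_le_mul hκL (hlip x hx y hy) (abs_nonneg _) hL0
    rw [e]
    calc _ ≤ A * (L * σu * |x - y|) * (L * σu) + A * (L * (L * σu * |x - y|)) := by
          refine (abs_add_le _ _).trans ?_
          rw [abs_mul, abs_mul (deriv f (sigmaFn a b y))]
          exact add_le_add (mul_le_mul h1 (hs x hx) (abs_nonneg _) (by positivity))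
            (mul_le_mul (HolderClass2.abs_deriv_le hA hf (hmap y hy)) h2 (abs_nonneg _) hA)
      _ = _ := by ring
  · unfold holderFactor
    apply le_of_eq
    ring

/-! ### The sup-norm distance and projections -/

theorem supDist_le_ofReal {f g : ℝ → ℝ} {r : ℝ} (h : ∀ x ∈ Icc (0 : ℝ) 1, |f x - g x| ≤ r) :
    supDist f g ≤ ENNReal.ofReal r :=
  iSup₂_le fun x hx => by
    rw [Real.enorm_eq_ofReal_abs]
    exact ENNReal.ofReal_le_ofReal (h x hx)

theorem abs_sub_le_of_supDist_le {f g : ℝ → ℝ} {r : ℝ} (hr : 0 ≤ r)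
    (h : supDist f g ≤ ENNReal.ofReal r) {x : ℝ} (hx : x ∈ Icc (0 : ℝ) 1) : |f x - g x| ≤ r := by
  have := (le_iSup₂ (f := fun x (_ : x ∈ Icc (0 : ℝ) 1) => ‖f x - g x‖ₑ) x hx).trans h
  rwa [Real.enorm_eq_ofReal_abs, ENNReal.ofReal_le_ofReal_iff hr] at this

/-- A sup-norm projection is, up to a factor of two, at least as good an approximation of a member
of the class as the function that is projected. -/
theorem IsSupProj.abs_sub_le {S : Set (ℝ → ℝ)} {f g k : ℝ → ℝ} (h : IsSupProj S f g) (hk : k ∈ S)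
    {r : ℝ} (hr : 0 ≤ r) (hkf : ∀ x ∈ Icc (0 : ℝ) 1, |f x - k x| ≤ r) {x : ℝ}
    (hx : x ∈ Icc (0 : ℝ) 1) : |g x - k x| ≤ 2 * r := by
  have h1 : supDist g f ≤ ENNReal.ofReal r :=
    (h.2 k hk).trans (supDist_le_ofReal fun x hx => by rw [abs_sub_comm]; exact hkf x hx)
  have h2 := abs_sub_le_of_supDist_le hr h1 hx
  calc |g x - k x| ≤ |g x - f x| + |f x - k x| := _root_.abs_sub_le _ _ _
    _ ≤ 2 * r := by linarith [hkf x hx]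

/-! ### Local linear weights -/

theorem posSemidef_sub_smul_one {m : Type*} [Fintype m] [DecidableEq m] {B : Matrix m m ℝ}
    (hB : B.IsHermitian) {lam : ℝ} (h : ∀ μ ∈ spectrum ℝ B, lam ≤ μ) :
    (B - lam • (1 : Matrix m m ℝ)).PosSemidef := by
  rw [Matrix.posSemidef_iff_isHermitian_and_spectrum_nonneg]
  refine ⟨hB.sub (by simp [Matrix.IsHermitian]), fun μ hμ => ?_⟩
  have : μ + lam ∈ spectrum ℝ B := by
    rw [← Algebra.algebraMap_eq_smul_one, ← spectrum.sub_singleton_eq] at hμ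
    obtain ⟨ν, hν, l, rfl, rfl⟩ := hμ
    simpa using hν
  have := h _ this
  simp only [mem_ofPred_eq]
  linarith

theorem isHermitian_llrMatrix {n : ℕ} (K : ℝ → ℝ) (X : Fin n → ℝ) (h x : ℝ) :
    (llrMatrix K X h x).IsHermitian := by
  ext i j
  simp only [llrMatrix, Matrix.conjTranspose_apply, Matrix.smul_apply, Matrix.sum_apply,
    Matrix.vecMulVec_apply, star_trivial]
  congr 1
  exact Finset.sum_congr rfl fun k _ => by rw [mul_comm (uVec _ j)]

theorem isUnit_det_llrMatrix {n : ℕ} {K : ℝ → ℝ} {X : Fin n → ℝ} {h x lam : ℝ} (hlam : 0 < lam)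
    (hspec : ∀ μ ∈ spectrum ℝ (llrMatrix K X h x), lam ≤ μ) : IsUnit (llrMatrix K X h x).det := by
  rw [← Matrix.isUnit_iff_isUnit_det]
  by_contra hu
  exact absurd (hspec 0 (spectrum.zero_mem_iff ℝ |>.2 hu)) (not_le.2 hlam)

/-- The first row of `B_{nx}(h)⁻¹`. -/
noncomputable def llrRow {n : ℕ} (K : ℝ → ℝ) (X : Fin n → ℝ) (h x : ℝ) : Fin 2 → ℝ :=
  uVec 0 ᵥ* (llrMatrix K X h x)⁻¹

theorem llrWeight_eq {n : ℕ} (K : ℝ → ℝ) (X : Fin n → ℝ) (h : ℝ) (i : Fin n) (x : ℝ) :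
    llrWeight K X h i x = 1 / ((n : ℝ) * h) *
      (llrRow K X h x 0 + llrRow K X h x 1 * ((X i - x) / h)) * K ((X i - x) / h) := by
  unfold llrWeight
  rw [Matrix.dotProduct_mulVec]
  congr 2
  simp [llrRow, dotProduct, Fin.sum_univ_two, uVec]

theorem llrRow_vecMul {n : ℕ} {K : ℝ → ℝ} {X : Fin n → ℝ} {h x : ℝ}
    (hdet : IsUnit (llrMatrix K X h x).det) :
    llrRow K X h x ᵥ* llrMatrix K X h x = uVec 0 := by
  rw [llrRow, Matrix.vecMul_vecMul, Matrix.nonsing_inv_mul _ hdet, Matrix.vecMul_one]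

theorem sum_llrWeight_mul_uVec {n : ℕ} {K : ℝ → ℝ} {X : Fin n → ℝ} {h x : ℝ}
    (hdet : IsUnit (llrMatrix K X h x).det) (k : Fin 2) :
    ∑ i, llrWeight K X h i x * uVec ((X i - x) / h) k = uVec 0 k := by
  rw [← llrRow_vecMul hdet]
  simp only [Matrix.vecMul, dotProduct, llrMatrix, Matrix.smul_apply, Matrix.sum_apply,
    Matrix.vecMulVec_apply, Fin.sum_univ_two, smul_eq_mul, llrWeight_eq, Finset.mul_sum]
  rw [← Finset.sum_add_distrib]
  refine Finset.sum_congr rfl fun i _ => ?_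
  simp only [uVec, Matrix.cons_val_zero, Matrix.cons_val_one]
  ring

/-- The local linear weights reproduce constants. -/
theorem sum_llrWeight {n : ℕ} {K : ℝ → ℝ} {X : Fin n → ℝ} {h x : ℝ}
    (hdet : IsUnit (llrMatrix K X h x).det) : ∑ i, llrWeight K X h i x = 1 := by
  simpa [uVec] using sum_llrWeight_mul_uVec hdet 0

/-- The local linear weights annihilate the deviations of the design points from `x`. -/
theorem sum_llrWeight_mul_sub {n : ℕ} {K : ℝ → ℝ} {X : Fin n → ℝ} {h x : ℝ} (hh : h ≠ 0)
    (hdet : IsUnit (llrMatrix K X h x).det) : ∑ i, llrWeight K X h i x * (X i - x) = 0 := by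
  have := sum_llrWeight_mul_uVec hdet 1
  simp only [uVec, Matrix.cons_val_one, Matrix.cons_val_fin_one, ← mul_div_assoc] at this
  rw [← Finset.sum_div, div_eq_zero_iff] at this
  exact this.resolve_right hh

theorem abs_llrRow_le {n : ℕ} {K : ℝ → ℝ} {X : Fin n → ℝ} {h x lam : ℝ} (hlam : 0 < lam)
    (hspec : ∀ μ ∈ spectrum ℝ (llrMatrix K X h x), lam ≤ μ) (k : Fin 2) :
    |llrRow K X h x k| ≤ 1 / lam := by
  set w := llrRow K X h x with hw
  have h1 := llrRow_vecMul (isUnit_det_llrMatrix hlam hspec)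
  rw [← hw] at h1
  have h2 := (posSemidef_sub_smul_one (isHermitian_llrMatrix K X h x) hspec).dotProduct_mulVec_nonneg w
  rw [star_trivial, Matrix.sub_mulVec, dotProduct_sub, Matrix.dotProduct_mulVec, h1,
    Matrix.smul_mulVec, Matrix.one_mulVec] at h2
  simp only [dotProduct, Fin.sum_univ_two, uVec, Matrix.cons_val_zero, Matrix.cons_val_one,
    Pi.smul_apply, smul_eq_mul] at h2
  have h2' : lam * (w 0 ^ 2 + w 1 ^ 2) ≤ w 0 := by linarith
  have hw0 : 0 ≤ w 0 := le_trans (by positivity) h2'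
  have hw0' : w 0 ≤ 1 / lam := by
    rw [le_div_iff₀ hlam]
    by_contra hc
    push Not at hc
    nlinarith [mul_nonneg hlam.le (sq_nonneg (w 1))]
  have hs : w 0 ^ 2 + w 1 ^ 2 ≤ (1 / lam) ^ 2 := by
    have : w 0 ^ 2 + w 1 ^ 2 ≤ 1 / lam * w 0 := by
      rw [one_div, inv_mul_eq_div, le_div_iff₀ hlam]
      linarith
    calc _ ≤ 1 / lam * w 0 := this
      _ ≤ 1 / lam * (1 / lam) := mul_le_mul_of_nonneg_left hw0' (by positivity)
      _ = _ := by ring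
  refine abs_le_of_sq_le_sq ?_ (by positivity)
  fin_cases k
  · simp only [Fin.zero_eta]
    nlinarith [sq_nonneg (w 1)]
  · simp only [Fin.mk_one]
    nlinarith [sq_nonneg (w 0)]

/-- Since the weights sum to one (or vanish), the effective sample size is at most `n`, by the
Cauchy-Schwarz inequality. -/
theorem effSampleSize_le {n : ℕ} (hn : 0 < n) (K : ℝ → ℝ) (X : Fin n → ℝ) (h : ℝ) :
    effSampleSize K X h ≤ n := by
  have hn' : (0 : ℝ) < n := by exact_mod_cast hn
  have key : ∀ j, 1 / ∑ i, llrWeight K X h i (X j) ^ 2 ≤ (n : ℝ) := by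
    intro j
    by_cases hdet : IsUnit (llrMatrix K X h (X j)).det
    · have hcs := sq_sum_le_card_mul_sum_sq (s := Finset.univ)
        (f := fun i => llrWeight K X h i (X j))
      rw [sum_llrWeight hdet, Finset.card_univ, Fintype.card_fin, one_pow] at hcs
      have hpos : 0 < ∑ i, llrWeight K X h i (X j) ^ 2 := by
        by_contra hc
        nlinarith
      rw [div_le_iff₀ hpos]
      exact hcs
    · simp [llrWeight, Matrix.nonsing_inv_apply_not_isUnit _ hdet]
  unfold effSampleSize
  calc _ ≤ 1 / (n : ℝ) * ∑ _j : Fin n, (n : ℝ) := by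
        gcongr with j
        exact key j
    _ = n := by
        rw [Finset.sum_const, Finset.card_univ, Fintype.card_fin, nsmul_eq_mul]
        field_simp

theorem effSampleSize_nonneg {n : ℕ} (K : ℝ → ℝ) (X : Fin n → ℝ) (h : ℝ) :
    0 ≤ effSampleSize K X h :=
  mul_nonneg (by positivity) (Finset.sum_nonneg fun _ _ =>
    one_div_nonneg.2 (Finset.sum_nonneg fun _ _ => sq_nonneg _))

/-- A sum over the design points that only involves those within `h` of `x` has at most
`2 a₀ n h` terms. -/
theorem sum_le_of_local {n : ℕ} (hn : 0 < n) {X : Fin n → ℝ} {a₀ h x G : ℝ} (ha₀ : 0 < a₀)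
    (hh : 0 < h) (hnh : 1 / (n : ℝ) ≤ 2 * h) (hX : ∀ i, X i ∈ Icc (0 : ℝ) 1)
    (hcount : ∀ I : Set ℝ, I ⊆ Icc 0 1 → I.OrdConnected →
      1 / (n : ℝ) * ({i | X i ∈ I} : Set (Fin n)).ncard ≤ a₀ * max (volume.real I) (1 / (n : ℝ)))
    (hG : 0 ≤ G) {g : Fin n → ℝ} (hg : ∀ i, g i ≤ G) (hg0 : ∀ i, h < |X i - x| → g i = 0) :
    ∑ i, g i ≤ G * (2 * a₀ * (n * h)) := by
  classical
  have hn' : (0 : ℝ) < n := by exact_mod_cast hn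
  set I : Set ℝ := Icc (x - h) (x + h) ∩ Icc 0 1
  have hc := hcount I inter_subset_right (ordConnected_Icc.inter ordConnected_Icc)
  have hvol : volume.real I ≤ 2 * h := by
    have h1 : volume.real I ≤ volume.real (Icc (x - h) (x + h)) :=
      measureReal_mono inter_subset_left (by simp)
    rw [Real.volume_real_Icc_of_le (by linarith)] at h1
    linarith
  have hcard : (({i | X i ∈ I} : Set (Fin n)).ncard : ℝ) ≤ 2 * a₀ * (n * h) := by
    have : 1 / (n : ℝ) * ({i | X i ∈ I} : Set (Fin n)).ncard ≤ a₀ * (2 * h) :=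
      hc.trans (mul_le_mul_of_nonneg_left (max_le hvol hnh) ha₀.le)
    rw [one_div, inv_mul_eq_div, div_le_iff₀ hn'] at this
    linarith
  have hsum : ∑ i, g i ≤ ∑ i, if X i ∈ I then G else 0 := by
    refine Finset.sum_le_sum fun i _ => ?_
    split_ifs with hi
    · exact hg i
    · refine (hg0 i ?_).le
      by_contra hc
      push Not at hc
      rw [abs_le] at hc
      exact hi ⟨⟨by linarith, by linarith⟩, hX i⟩
  refine hsum.trans ?_
  rw [← Finset.sum_filter, Finset.sum_const, nsmul_eq_mul, mul_comm]
  refine mul_le_mul_of_nonneg_left ?_ hG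
  rwa [Set.ncard_eq_toFinset_card', Set.toFinset_ofPred] at hcard

theorem kernel_eq_zero_of_lt {K : ℝ → ℝ} (hK : ∀ z, z ∉ Icc (-1 : ℝ) 1 → K z = 0) {h d : ℝ}
    (hh : 0 < h) (hd : h < |d|) : K (d / h) = 0 := by
  refine hK _ fun hz => ?_
  have := abs_le.2 hz
  rw [abs_div, abs_of_pos hh, div_le_one hh] at this
  linarith

/-- The `ℓ¹` norm of the local linear weights is bounded. -/
theorem sum_abs_llrWeight_le {n : ℕ} (hn : 0 < n) {K : ℝ → ℝ} {X : Fin n → ℝ}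
    {a₀ K₀ h x lam : ℝ} (ha₀ : 0 < a₀) (hK₀ : 0 ≤ K₀) (hlam : 0 < lam)
    (hh : 0 < h) (hnh : 1 / (n : ℝ) ≤ 2 * h) (hX : ∀ i, X i ∈ Icc (0 : ℝ) 1)
    (hcount : ∀ I : Set ℝ, I ⊆ Icc 0 1 → I.OrdConnected →
      1 / (n : ℝ) * ({i | X i ∈ I} : Set (Fin n)).ncard ≤ a₀ * max (volume.real I) (1 / (n : ℝ)))
    (hK : ∀ z, z ∉ Icc (-1 : ℝ) 1 → K z = 0) (hKb : ∀ z, |K z| ≤ K₀)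
    (hspec : ∀ μ ∈ spectrum ℝ (llrMatrix K X h x), lam ≤ μ) :
    ∑ i, |llrWeight K X h i x| ≤ 4 * a₀ * K₀ / lam := by
  have hn' : (0 : ℝ) < n := by exact_mod_cast hn
  have hb : ∀ i, |llrWeight K X h i x| ≤ 1 / (n * h) * (2 / lam) * K₀ := by
    intro i
    by_cases hi : h < |X i - x|
    · rw [llrWeight_eq, kernel_eq_zero_of_lt hK hh hi, mul_zero, abs_zero]
      positivity
    · push Not at hi
      rw [llrWeight_eq, abs_mul, abs_mul, abs_of_nonneg (show 0 ≤ 1 / (n * h) by positivity)]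
      have hz : |(X i - x) / h| ≤ 1 := by rwa [abs_div, abs_of_pos hh, div_le_one hh]
      have : |llrRow K X h x 0 + llrRow K X h x 1 * ((X i - x) / h)| ≤ 2 / lam := by
        refine (abs_add_le _ _).trans ?_
        rw [abs_mul]
        calc _ ≤ 1 / lam + 1 / lam * 1 := add_le_add (abs_llrRow_le hlam hspec 0)
              (mul_le_mul (abs_llrRow_le hlam hspec 1) hz (abs_nonneg _) (by positivity))
          _ = 2 / lam := by ring
      gcongr
      exact hKb _
  refine (sum_le_of_local (x := x) hn ha₀ hh hnh hX hcount (by positivity) hb fun i hi => ?_).trans ?_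
  · rw [llrWeight_eq, kernel_eq_zero_of_lt hK hh hi, mul_zero, abs_zero]
  · apply le_of_eq
    field_simp
    ring

/-- The bias of local linear regression is of order `h²` for functions that are linear near `x` up
to a quadratic error. -/
theorem abs_localLinear_sub_le {n : ℕ} {K : ℝ → ℝ} {X : Fin n → ℝ} {h x Λ H d : ℝ} {f : ℝ → ℝ}
    (hh : 0 < h) (hK : ∀ z, z ∉ Icc (-1 : ℝ) 1 → K z = 0) (hH : 0 ≤ H)
    (hdet : IsUnit (llrMatrix K X h x).det) (hΛ : ∑ i, |llrWeight K X h i x| ≤ Λ)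
    (hf : ∀ i, |f (X i) - f x - d * (X i - x)| ≤ H * (X i - x) ^ 2) :
    |localLinear K X h (fun i => f (X i)) x - f x| ≤ Λ * (H * h ^ 2) := by
  have e : localLinear K X h (fun i => f (X i)) x - f x =
      ∑ i, llrWeight K X h i x * (f (X i) - f x - d * (X i - x)) := by
    have h1 : ∀ i, llrWeight K X h i x * (f (X i) - f x - d * (X i - x)) =
      llrWeight K X h i x * f (X i) - llrWeight K X h i x * f x -
        d * (llrWeight K X h i x * (X i - x)) := fun i => by ring
    simp only [h1]
    rw [Finset.sum_sub_distrib, Finset.sum_sub_distrib, ← Finset.sum_mul, ← Finset.mul_sum,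
      sum_llrWeight hdet, sum_llrWeight_mul_sub hh.ne' hdet, localLinear]
    ring
  rw [e]
  calc _ ≤ ∑ i, |llrWeight K X h i x| * (H * h ^ 2) := by
        refine (Finset.abs_sum_le_sum_abs _ _).trans (Finset.sum_le_sum fun i _ => ?_)
        rw [abs_mul]
        by_cases hi : h < |X i - x|
        · rw [llrWeight_eq, kernel_eq_zero_of_lt hK hh hi, mul_zero, abs_zero, zero_mul, zero_mul]
        · push Not at hi
          refine mul_le_mul_of_nonneg_left ((hf i).trans ?_) (abs_nonneg _)
          rw [← sq_abs (X i - x)]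
          gcongr
    _ ≤ _ := by
        rw [← Finset.sum_mul]
        gcongr

/-- Control of the weighted sums of a sequence `ξ` with weights from the kernel classes controls
its local linear regression. -/
theorem abs_localLinear_le_of_kernel_sums {n : ℕ} (hn : 0 < n) {K : ℝ → ℝ} {X : Fin n → ℝ}
    {h x lam T : ℝ} (hh : 0 < h) (hlam : 0 < lam)
    (hspec : ∀ μ ∈ spectrum ℝ (llrMatrix K X h x), lam ≤ μ) (ξ : Fin n → ℝ)
    (h1 : |∑ i, K ((X i - x) / h) * ξ i| ≤ T)
    (h2 : |∑ i, (X i - x) / h * K ((X i - x) / h) * ξ i| ≤ T) :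
    |localLinear K X h ξ x| ≤ 2 / lam * T / (n * h) := by
  have hn' : (0 : ℝ) < n := by exact_mod_cast hn
  have e : localLinear K X h ξ x = (llrRow K X h x 0 * ∑ i, K ((X i - x) / h) * ξ i +
      llrRow K X h x 1 * ∑ i, (X i - x) / h * K ((X i - x) / h) * ξ i) / (n * h) := by
    rw [localLinear, Finset.mul_sum, Finset.mul_sum, ← Finset.sum_add_distrib, Finset.sum_div]
    refine Finset.sum_congr rfl fun i _ => ?_
    rw [llrWeight_eq]
    ring
  rw [e, abs_div, abs_of_pos (show 0 < (n : ℝ) * h by positivity)]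
  gcongr
  refine (abs_add_le _ _).trans ?_
  rw [abs_mul, abs_mul]
  calc _ ≤ 1 / lam * T + 1 / lam * T := add_le_add
        (mul_le_mul (abs_llrRow_le hlam hspec 0) h1 (abs_nonneg _) (by positivity))
        (mul_le_mul (abs_llrRow_le hlam hspec 1) h2 (abs_nonneg _) (by positivity))
    _ = _ := by ring

/-! ### Covering the kernel classes on the design points -/

theorem exists_cover_of_coveringNumberL2_le {Q : Measure ℝ} {F : Set (ℝ → ℝ)} {ε x : ℝ}
    (hx : 0 ≤ x) (h : (coveringNumberL2 Q F ε : ℝ≥0∞) ≤ ENNReal.ofReal x) :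
    ∃ T : Finset (ℝ → ℝ), (T.card : ℝ) ≤ x ∧
      ∀ f ∈ F, ∃ g ∈ T, eLpNorm (fun y => f y - g y) 2 Q < ENNReal.ofReal ε := by
  by_contra hc
  push Not at hc
  have h1 : ((⌊x⌋₊ + 1 : ℕ) : ℕ∞) ≤ coveringNumberL2 Q F ε := by
    refine le_iInf₂ fun T hT => ?_
    have : x < T.card := by
      by_contra hlt
      push Not at hlt
      obtain ⟨f, hf, hfT⟩ := hc T hlt
      obtain ⟨g, hg, hlt'⟩ := hT f hf
      exact absurd hlt' (not_lt.2 (hfT g hg))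
    exact_mod_cast (Nat.floor_lt hx).2 this
  have h2 : ((⌊x⌋₊ + 1 : ℕ) : ℝ≥0∞) ≤ ENNReal.ofReal x := by
    refine le_trans ?_ h
    have := ENat.toENNReal_le.2 h1
    simpa using this
  rw [← ENNReal.ofReal_natCast, ENNReal.ofReal_le_ofReal_iff hx] at h2
  have := Nat.lt_floor_add_one x
  push_cast at h2
  linarith

/-- The empirical measure of the design points. -/
noncomputable def empiricalMeasure {n : ℕ} (X : Fin n → ℝ) : Measure ℝ :=
  (n : ℝ≥0∞)⁻¹ • ∑ i, Measure.dirac (X i)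

theorem isProbabilityMeasure_empiricalMeasure {n : ℕ} (hn : 0 < n) (X : Fin n → ℝ) :
    IsProbabilityMeasure (empiricalMeasure X) := by
  refine ⟨?_⟩
  simp only [empiricalMeasure, Measure.smul_apply, Measure.finsetSum_apply, measure_univ,
    Finset.sum_const, Finset.card_univ, Fintype.card_fin, smul_eq_mul, nsmul_eq_mul, mul_one]
  exact ENNReal.inv_mul_cancel (by exact_mod_cast hn.ne') (ENNReal.natCast_ne_top n)

theorem empiricalMeasure_compl_image {n : ℕ} (X : Fin n → ℝ) :
    empiricalMeasure X ((Finset.univ.image X : Finset ℝ) : Set ℝ)ᶜ = 0 := by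
  simp [empiricalMeasure, Measure.smul_apply, Measure.finsetSum_apply]

/-- Proximity in `L₂` of the empirical measure implies proximity at the design points, with the
loss of a factor of at most `n`. -/
theorem abs_le_of_eLpNorm_empiricalMeasure_lt {n : ℕ} (hn : 0 < n) {X : Fin n → ℝ} {f : ℝ → ℝ}
    {ε : ℝ} (hε : 0 ≤ ε) (h : eLpNorm f 2 (empiricalMeasure X) < ENNReal.ofReal ε) (i : Fin n) :
    |f (X i)| ≤ n * ε := by
  have hn1 : (1 : ℝ) ≤ n := by exact_mod_cast hn
  have hle : (n : ℝ≥0∞)⁻¹ • Measure.dirac (X i) ≤ empiricalMeasure X := by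
    refine Measure.le_iff.2 fun s _ => ?_
    simp only [empiricalMeasure, Measure.smul_apply, Measure.finsetSum_apply, smul_eq_mul]
    gcongr
    exact Finset.single_le_sum (f := fun i => Measure.dirac (X i) s) (fun _ _ => zero_le)
      (Finset.mem_univ i)
  have h1 := (eLpNorm_mono_measure f hle).trans_lt h
  rw [eLpNorm_smul_measure_of_ne_top (by norm_num)] at h1
  have hd : eLpNorm f 2 (Measure.dirac (X i)) = ‖f (X i)‖ₑ := by
    rw [eLpNorm_eq_lintegral_rpow_enorm_toReal (by norm_num) (by norm_num), lintegral_dirac,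
      ← ENNReal.rpow_mul]
    norm_num
  rw [hd] at h1
  have h2 := ENNReal.toReal_mono ENNReal.ofReal_ne_top h1.le
  simp only [smul_eq_mul, ENNReal.toReal_mul, toReal_enorm, ENNReal.toReal_ofReal hε,
    Real.norm_eq_abs, ← ENNReal.toReal_rpow, ENNReal.toReal_inv, ENNReal.toReal_natCast] at h2
  have h3 : (n : ℝ)⁻¹ ≤ (n : ℝ)⁻¹ ^ (1 / (2 : ℝ≥0∞)).toReal := by
    refine Real.self_le_rpow_of_le_one (by positivity) (inv_le_one_of_one_le₀ hn1) ?_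
    norm_num
  have h4 : (n : ℝ)⁻¹ * |f (X i)| ≤ ε := by
    refine le_trans ?_ h2
    gcongr
  rwa [inv_mul_le_iff₀ (by linarith)] at h4

/-- Polynomially many members of a kernel class approximate all of it at the design points. -/
theorem exists_kernelClass_net {n : ℕ} (hn : 0 < n) (X : Fin n → ℝ) {K : ℝ → ℝ}
    {Ch K₀ CK VK : ℝ} (hCK : 0 < CK) (hK : RegularKernel K Ch K₀ CK VK) {k : ℕ}
    (hk : k = 1 ∨ k = 2) :
    ∃ T : Finset (ℝ → ℝ), (T.card : ℝ) ≤ CK * ((n : ℝ) ^ 2) ^ VK ∧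
      (∀ g ∈ T, g ∈ kernelClass K Ch n k) ∧
      ∀ f ∈ kernelClass K Ch n k, ∃ g ∈ T, ∀ i, |f (X i) - g (X i)| ≤ 2 / n := by
  classical
  have hn1 : (1 : ℝ) ≤ n := by exact_mod_cast hn
  have hn0 : (n : ℝ) ≠ 0 := by positivity
  have hε : (0 : ℝ) < 1 / (n : ℝ) ^ 2 := by positivity
  have hcov := hK.2.2 n hn k hk (empiricalMeasure X) (isProbabilityMeasure_empiricalMeasure hn X)
    ⟨_, empiricalMeasure_compl_image X⟩ (1 / (n : ℝ) ^ 2) hε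
    (by rw [div_le_one (by positivity)]; exact one_le_pow₀ hn1)
  rw [one_div_one_div] at hcov
  obtain ⟨T, hTc, hT⟩ := exists_cover_of_coveringNumberL2_le (by positivity) hcov
  have hT' : ∀ f ∈ kernelClass K Ch n k, ∃ g ∈ T, ∀ i, |f (X i) - g (X i)| ≤ 1 / n := by
    intro f hf
    obtain ⟨g, hg, hlt⟩ := hT f hf
    refine ⟨g, hg, fun i => ?_⟩
    refine (abs_le_of_eLpNorm_empiricalMeasure_lt hn hε.le hlt i).trans (le_of_eq ?_)
    field_simp
  -- replace each useful centre by a member of the class nearby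
  set good : (ℝ → ℝ) → Prop := fun g => ∃ f ∈ kernelClass K Ch n k,
    ∀ i, |f (X i) - g (X i)| ≤ 1 / n with hgood
  set r : (ℝ → ℝ) → (ℝ → ℝ) := fun g => if hg : good g then hg.choose else g with hr
  have hr1 : ∀ g, good g → r g ∈ kernelClass K Ch n k ∧ ∀ i, |r g (X i) - g (X i)| ≤ 1 / n := by
    intro g hg
    simp only [hr, dif_pos hg]
    exact hg.choose_spec
  refine ⟨(T.filter good).image r, ?_, ?_, ?_⟩
  · refine le_trans ?_ hTc
    exact_mod_cast Finset.card_image_le.trans (Finset.card_filter_le _ _)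
  · intro g hg
    obtain ⟨g', hg', rfl⟩ := Finset.mem_image.1 hg
    exact (hr1 g' (Finset.mem_filter.1 hg').2).1
  · intro f hf
    obtain ⟨g, hg, hfg⟩ := hT' f hf
    have hgg : good g := ⟨f, hf, hfg⟩
    refine ⟨r g, Finset.mem_image_of_mem r (Finset.mem_filter.2 ⟨hg, hgg⟩), fun i => ?_⟩
    have h1 := (hr1 g hgg).2 i
    rw [abs_sub_comm] at h1
    calc _ ≤ |f (X i) - g (X i)| + |g (X i) - r g (X i)| := abs_sub_le _ _ _
      _ ≤ 1 / n + 1 / n := add_le_add (hfg i) h1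
      _ = 2 / n := by ring

/-! ### Exponential inequalities for the kernel sums -/

theorem measure_abs_weighted_sum_ge_le {Ω : Type*} [MeasurableSpace Ω] {P : Measure Ω}
    [IsProbabilityMeasure P] {n : ℕ} {ζ : Fin n → Ω → ℝ} (hm : ∀ i, Measurable (ζ i))
    (hind : iIndepFun ζ P) {M S u : ℝ} (hM : 0 < M) (hS : 0 < S) (hu : 0 ≤ u)
    (hb : ∀ i ω, |ζ i ω| ≤ M) {g : Fin n → ℝ} (hg : ∑ i, g i ^ 2 ≤ S) :
    P {ω | u ≤ |∑ i, g i * (ζ i ω - ∫ ω, ζ i ω ∂P)|} ≤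
      ENNReal.ofReal (2 * Real.exp (-u ^ 2 / (2 * (M ^ 2 * S)))) := by
  have one : ∀ g : Fin n → ℝ, ∑ i, g i ^ 2 ≤ S →
      P.real {ω | u ≤ ∑ i, g i * (ζ i ω - ∫ ω, ζ i ω ∂P)} ≤
        Real.exp (-u ^ 2 / (2 * (M ^ 2 * S))) := by
    intro g hg
    have hsub : ∀ i ∈ Finset.univ, HasSubgaussianMGF
        (fun ω => g i * (ζ i ω - ∫ ω, ζ i ω ∂P)) (.mk ((g i) ^ 2) (sq_nonneg _) *
          (‖M - (-M)‖₊ / 2) ^ 2) P := fun i _ =>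
      (hasSubgaussianMGF_of_mem_Icc (hm i).aemeasurable
        (Filter.Eventually.of_forall fun ω => abs_le.1 (hb i ω))).const_mul (g i)
    have hind' : iIndepFun (fun i ω => g i * (ζ i ω - ∫ ω, ζ i ω ∂P)) P :=
      hind.comp (fun i y => g i * (y - ∫ ω, ζ i ω ∂P)) fun i => by fun_prop
    have hsum := HasSubgaussianMGF.sum_of_iIndepFun hind' hsub
    have hc : ((∑ i, (.mk ((g i) ^ 2) (sq_nonneg _) * (‖M - (-M)‖₊ / 2) ^ 2 : NNReal) : NNReal) :
        ℝ) = M ^ 2 * ∑ i, g i ^ 2 := by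
      rw [NNReal.coe_sum, Finset.mul_sum]
      refine Finset.sum_congr rfl fun i _ => ?_
      push_cast
      rw [show M - -M = 2 * M by ring, Real.norm_eq_abs, abs_of_pos (by positivity),
        mul_div_cancel_left₀ _ two_ne_zero, mul_comm]
    -- enlarging the variance proxy also covers the case where all weights vanish
    have hsum' : HasSubgaussianMGF (fun ω => ∑ i, g i * (ζ i ω - ∫ ω, ζ i ω ∂P))
        (.mk (M ^ 2 * S) (by positivity)) P := by
      refine ⟨hsum.integrable_exp_mul, fun t => (hsum.mgf_le t).trans (Real.exp_le_exp.2 ?_)⟩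
      rw [hc, NNReal.coe_mk]
      gcongr
    exact hsum'.measure_ge_le hu
  have h1 := one g hg
  have h2 := one (fun i => -g i) (by simpa using hg)
  have hsub : {ω | u ≤ |∑ i, g i * (ζ i ω - ∫ ω, ζ i ω ∂P)|} ⊆
      {ω | u ≤ ∑ i, g i * (ζ i ω - ∫ ω, ζ i ω ∂P)} ∪
        {ω | u ≤ ∑ i, -g i * (ζ i ω - ∫ ω, ζ i ω ∂P)} := by
    intro ω hω
    rcases le_abs.1 (show u ≤ |_| from hω) with h | h
    · exact Or.inl h
    · refine Or.inr ?_
      simpa only [mem_ofPred_eq, neg_mul, Finset.sum_neg_distrib] using h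
  refine (measure_mono hsub).trans ((measure_union_le _ _).trans ?_)
  rw [two_mul, ENNReal.ofReal_add (Real.exp_pos _).le (Real.exp_pos _).le]
  exact add_le_add ((ENNReal.le_ofReal_iff_toReal_le (measure_ne_top _ _) (Real.exp_pos _).le).2 h1)
    ((ENNReal.le_ofReal_iff_toReal_le (measure_ne_top _ _) (Real.exp_pos _).le).2 h2)

/-- The effect of truncation on the mean is bounded by a second moment and a tail probability,
by the inequality between the arithmetic and the geometric mean with weight `η`. -/
theorem abs_integral_indicator_sub_le {Ω : Type*} [MeasurableSpace Ω] {P : Measure Ω}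
    [IsProbabilityMeasure P] {f : Ω → ℝ} (hf : MemLp f 2 P) {E : Set Ω} (hE : MeasurableSet E)
    {η : ℝ} (hη : 0 < η) :
    |∫ ω, E.indicator f ω ∂P - ∫ ω, f ω ∂P| ≤ η * ∫ ω, f ω ^ 2 ∂P + η⁻¹ * P.real Eᶜ := by
  have hfi : Integrable f P := hf.integrable (by norm_num)
  have hf2 : Integrable (fun ω => f ω ^ 2) P := hf.integrable_sq
  have hind : Integrable (Eᶜ.indicator fun _ => (1 : ℝ)) P :=
    (integrable_const _).indicator hE.compl
  rw [← integral_sub (hfi.indicator hE) hfi, ← Real.norm_eq_abs]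
  refine (norm_integral_le_integral_norm _).trans ?_
  calc _ ≤ ∫ ω, η * f ω ^ 2 + η⁻¹ * Eᶜ.indicator (fun _ => (1 : ℝ)) ω ∂P := by
        refine integral_mono ((hfi.indicator hE).sub hfi).norm
          ((hf2.const_mul _).add (hind.const_mul _)) fun ω => ?_
        by_cases hω : ω ∈ E
        · simp only [indicator_of_mem hω, sub_self, norm_zero]
          rw [indicator_of_notMem (by simpa using hω)]
          positivity
        · rw [indicator_of_notMem hω, indicator_of_mem (by simpa using hω), zero_sub, norm_neg,
            Real.norm_eq_abs]
          have h1 : 0 ≤ η⁻¹ * (η * |f ω| - 1) ^ 2 := by positivity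
          have h2 : η⁻¹ * (η * |f ω| - 1) ^ 2 = η * |f ω| ^ 2 - 2 * |f ω| + η⁻¹ := by
            field_simp
            ring
          rw [sq_abs] at h2
          have := abs_nonneg (f ω)
          linarith
    _ = _ := by
        rw [integral_add (hf2.const_mul _) (hind.const_mul _), integral_const_mul,
          integral_const_mul, integral_indicator_const _ hE.compl]
        simp

/-- Uniform control of the weighted sums of `φ(εᵢ) - E φ(εᵢ)` over a class of weights that has a
finite net at the design points: truncation of the errors at `M`, a union bound over the net, and
Hoeffding's inequality for each member of the net. -/
theorem measure_exists_weighted_sum_gt_le {Ω : Type*} [MeasurableSpace Ω] {P : Measure Ω}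
    [IsProbabilityMeasure P] {n : ℕ} (hn : 0 < n) {ε : Fin n → Ω → ℝ}
    (hm : ∀ i, Measurable (ε i)) (hind : iIndepFun ε P) {φ : ℝ → ℝ} (hφ : Measurable φ)
    {M M' D S u K₀ : ℝ} (hM' : 0 < M') (hS : 0 < S) (hu : 0 ≤ u)
    (hφM : ∀ y, |y| ≤ M → |φ y| ≤ M') (hL2 : ∀ i, MemLp (fun ω => φ (ε i ω)) 2 P)
    (hD : ∀ i, ∫ ω, φ (ε i ω) ^ 2 ∂P ≤ D)
    (htail : ∀ i, P.real {ω | M < |ε i ω|} ≤ 1 / (n : ℝ) ^ 2)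
    {X : Fin n → ℝ} {F : Set (ℝ → ℝ)} {T : Finset (ℝ → ℝ)} (hTF : ∀ g ∈ T, g ∈ F)
    (hT : ∀ f ∈ F, ∃ g ∈ T, ∀ i, |f (X i) - g (X i)| ≤ 2 / n)
    (hFS : ∀ f ∈ F, ∑ i, f (X i) ^ 2 ≤ S) (hFK : ∀ f ∈ F, ∀ y, |f y| ≤ K₀) :
    P {ω | (∀ i, |ε i ω| ≤ M) ∧ ∃ f ∈ F, u + 4 * M' + K₀ * (D + 1) <
        |∑ i, f (X i) * (φ (ε i ω) - ∫ ω, φ (ε i ω) ∂P)|} ≤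
      ENNReal.ofReal (T.card * (2 * Real.exp (-u ^ 2 / (2 * (M' ^ 2 * S))))) := by
  have hn' : (0 : ℝ) < n := by exact_mod_cast hn
  set ψ : ℝ → ℝ := (Icc (-M) M).indicator φ with hψ
  have hψm : Measurable ψ := hφ.indicator measurableSet_Icc
  have hψb : ∀ y, |ψ y| ≤ M' := by
    intro y
    by_cases hy : y ∈ Icc (-M) M
    · rw [hψ, indicator_of_mem hy]
      exact hφM y (abs_le.2 hy)
    · rw [hψ, indicator_of_notMem hy, abs_zero]
      exact hM'.le
  set ζ : Fin n → Ω → ℝ := fun i ω => ψ (ε i ω) with hζ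
  have hζm : ∀ i, Measurable (ζ i) := fun i => hψm.comp (hm i)
  have hζind : iIndepFun ζ P := hind.comp (fun _ => ψ) fun _ => hψm
  have hζE : ∀ i, |∫ ω, ζ i ω ∂P| ≤ M' := fun i => by
    have := norm_integral_le_of_norm_le_const (μ := P) (f := ζ i) (C := M')
      (Filter.Eventually.of_forall fun ω => hψb _)
    simpa using this
  have hbias : ∀ i, |∫ ω, ζ i ω ∂P - ∫ ω, φ (ε i ω) ∂P| ≤ (D + 1) / n := by
    intro i
    have hE : MeasurableSet (ε i ⁻¹' Icc (-M) M) := hm i measurableSet_Icc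
    have h1 := abs_integral_indicator_sub_le (hL2 i) hE (η := 1 / n) (by positivity)
    have e : (fun ω => (ε i ⁻¹' Icc (-M) M).indicator (fun ω => φ (ε i ω)) ω) = ζ i := by
      ext ω
      simp only [hζ, hψ, indicator, mem_preimage]
      split_ifs <;> rfl
    simp only [e] at h1
    refine h1.trans ?_
    have ec : (ε i ⁻¹' Icc (-M) M)ᶜ = {ω | M < |ε i ω|} := by
      ext ω
      simp only [mem_compl_iff, mem_preimage, mem_ofPred_eq, not_le,
        show ∀ y : ℝ, y ∈ Icc (-M) M ↔ |y| ≤ M from fun y => abs_le.symm]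
    rw [ec]
    calc _ ≤ 1 / (n : ℝ) * D + (1 / (n : ℝ))⁻¹ * (1 / (n : ℝ) ^ 2) := by
          gcongr
          · exact hD i
          · exact htail i
      _ = (D + 1) / n := by
          field_simp
  have hsub : {ω | (∀ i, |ε i ω| ≤ M) ∧ ∃ f ∈ F, u + 4 * M' + K₀ * (D + 1) <
        |∑ i, f (X i) * (φ (ε i ω) - ∫ ω, φ (ε i ω) ∂P)|} ⊆
      ⋃ g ∈ T, {ω | u ≤ |∑ i, g (X i) * (ζ i ω - ∫ ω, ζ i ω ∂P)|} := by
    rintro ω ⟨hω, f, hf, hgt⟩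
    obtain ⟨g, hg, hfg⟩ := hT f hf
    refine mem_iUnion₂.2 ⟨g, hg, ?_⟩
    by_contra hlt
    simp only [mem_ofPred_eq, not_le] at hlt
    have hζω : ∀ i, ζ i ω = φ (ε i ω) := fun i => by
      simp only [hζ, hψ, indicator_of_mem (show ε i ω ∈ Icc (-M) M from abs_le.1 (hω i))]
    have e : ∑ i, f (X i) * (φ (ε i ω) - ∫ ω, φ (ε i ω) ∂P) =
        ∑ i, g (X i) * (ζ i ω - ∫ ω, ζ i ω ∂P) +
        ∑ i, (f (X i) - g (X i)) * (ζ i ω - ∫ ω, ζ i ω ∂P) +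
        ∑ i, f (X i) * (∫ ω, ζ i ω ∂P - ∫ ω, φ (ε i ω) ∂P) := by
      rw [← Finset.sum_add_distrib, ← Finset.sum_add_distrib]
      refine Finset.sum_congr rfl fun i _ => ?_
      rw [hζω]
      ring
    have h2 : |∑ i, (f (X i) - g (X i)) * (ζ i ω - ∫ ω, ζ i ω ∂P)| ≤ 4 * M' := by
      calc _ ≤ ∑ _i : Fin n, 2 / (n : ℝ) * (M' + M') := by
            refine (Finset.abs_sum_le_sum_abs _ _).trans (Finset.sum_le_sum fun i _ => ?_)
            rw [abs_mul]
            exact mul_le_mul (hfg i) ((abs_sub _ _).trans (add_le_add (hψb _) (hζE i)))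
              (abs_nonneg _) (by positivity)
        _ = 4 * M' := by
            rw [Finset.sum_const, Finset.card_univ, Fintype.card_fin, nsmul_eq_mul]
            field_simp
            ring
    have h3 : |∑ i, f (X i) * (∫ ω, ζ i ω ∂P - ∫ ω, φ (ε i ω) ∂P)| ≤ K₀ * (D + 1) := by
      calc _ ≤ ∑ _i : Fin n, K₀ * ((D + 1) / n) := by
            refine (Finset.abs_sum_le_sum_abs _ _).trans (Finset.sum_le_sum fun i _ => ?_)
            rw [abs_mul]
            exact mul_le_mul (hFK f hf _) (hbias i) (abs_nonneg _)
              ((abs_nonneg _).trans (hFK f hf 0))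
        _ = _ := by
            rw [Finset.sum_const, Finset.card_univ, Fintype.card_fin, nsmul_eq_mul]
            field_simp
    rw [e] at hgt
    have h4 := abs_add_three (∑ i, g (X i) * (ζ i ω - ∫ ω, ζ i ω ∂P))
      (∑ i, (f (X i) - g (X i)) * (ζ i ω - ∫ ω, ζ i ω ∂P))
      (∑ i, f (X i) * (∫ ω, ζ i ω ∂P - ∫ ω, φ (ε i ω) ∂P))
    linarith
  refine (measure_mono hsub).trans ((measure_biUnion_finset_le _ _).trans ?_)
  calc _ ≤ ∑ _g ∈ T, ENNReal.ofReal (2 * Real.exp (-u ^ 2 / (2 * (M' ^ 2 * S)))) :=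
        Finset.sum_le_sum fun g hg => measure_abs_weighted_sum_ge_le hζm hζind hM' hS hu
          (fun i ω => hψb _) (hFS g (hTF g hg))
    _ = _ := by
        rw [Finset.sum_const, nsmul_eq_mul, ENNReal.ofReal_mul (Nat.cast_nonneg T.card),
          ENNReal.ofReal_natCast]

/-! ### Moments and tails of the errors -/

/-- The fourth moment of the standard normal law. -/
noncomputable def gaussianFourthMoment : ℝ := ∫ x, x ^ 4 ∂(gaussianReal 0 1)

theorem gaussianFourthMoment_nonneg : 0 ≤ gaussianFourthMoment :=
  integral_nonneg fun _ => by positivity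

theorem integral_pow_four_gaussianReal (σ : ℝ) :
    ∫ x, x ^ 4 ∂(gaussianReal 0 (Real.toNNReal (σ ^ 2))) = σ ^ 4 * gaussianFourthMoment := by
  have h := gaussianReal_map_const_mul (μ := 0) (v := 1) σ
  have e : (NNReal.mk (σ ^ 2) (sq_nonneg σ)) * 1 = Real.toNNReal (σ ^ 2) := by
    rw [mul_one, Real.toNNReal_of_nonneg (sq_nonneg _)]
  rw [mul_zero, e] at h
  rw [← h, integral_map (by fun_prop) (by fun_prop), gaussianFourthMoment, ← integral_const_mul]
  exact integral_congr_ae (Filter.Eventually.of_forall fun x => by ring)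

theorem MomentControl.memLp {G₀ : Measure ℝ} {A₀ α : ℝ} (hG : MomentControl G₀ A₀ α) {p : ℝ}
    (hp : 1 ≤ p) : MemLp (fun τ : ℝ => τ) (ENNReal.ofReal p) G₀ :=
  ⟨by fun_prop, (hG.2.2 p hp).trans_lt ENNReal.ofReal_lt_top⟩

theorem MomentControl.memLp_four {G₀ : Measure ℝ} {A₀ α : ℝ} (hG : MomentControl G₀ A₀ α) :
    MemLp (fun τ : ℝ => τ) 4 G₀ := by
  simpa using hG.memLp (p := 4) (by norm_num)

theorem MomentControl.integral_sq {G₀ : Measure ℝ} [IsProbabilityMeasure G₀] {A₀ α : ℝ}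
    (hG : MomentControl G₀ A₀ α) : ∫ τ, τ ^ 2 ∂G₀ = 1 := by
  have h := hG.2.1
  rw [variance_of_integral_eq_zero (by fun_prop) hG.1] at h
  exact h

theorem MomentControl.integral_pow_four_le {G₀ : Measure ℝ} {A₀ α : ℝ} (hA₀ : 0 < A₀)
    (hG : MomentControl G₀ A₀ α) : ∫ τ, τ ^ 4 ∂G₀ ≤ (A₀ * 4 ^ (1 / α)) ^ 4 := by
  have h := hG.2.2 4 (by norm_num)
  rw [show ENNReal.ofReal 4 = 4 by simp,
    hG.memLp_four.eLpNorm_eq_integral_rpow_norm (by norm_num) (by norm_num),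
    ENNReal.ofReal_le_ofReal_iff (by positivity)] at h
  have e : ∫ τ : ℝ, ‖τ‖ ^ (4 : ℝ≥0∞).toReal ∂G₀ = ∫ τ, τ ^ 4 ∂G₀ := by
    refine integral_congr_ae (Filter.Eventually.of_forall fun x => ?_)
    simp only [ENNReal.toReal_ofNat, Real.norm_eq_abs]
    rw [show (4 : ℝ) = ((4 : ℕ) : ℝ) by norm_num, Real.rpow_natCast]
    exact Even.pow_abs (by decide) x
  rw [e] at h
  have h0 : 0 ≤ ∫ τ, τ ^ 4 ∂G₀ := integral_nonneg fun _ => by positivity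
  have h1 := pow_le_pow_left₀ (Real.rpow_nonneg h0 _) h 4
  rwa [← Real.rpow_natCast, ← Real.rpow_mul h0, ENNReal.toReal_ofNat, Nat.cast_ofNat,
    inv_mul_cancel₀ (by norm_num), Real.rpow_one] at h1

/-- The moment condition yields exponential tails, by Markov's inequality for the `p`-th
moment. -/
theorem MomentControl.measure_ge_le {G₀ : Measure ℝ} {A₀ α : ℝ} (hA₀ : 0 < A₀)
    (hG : MomentControl G₀ A₀ α) {p : ℝ} (hp : 1 ≤ p) :
    G₀ {τ | Real.exp 1 * (A₀ * p ^ (1 / α)) ≤ |τ|} ≤ ENNReal.ofReal (Real.exp (-p)) := by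
  have hp0 : 0 < p := by linarith
  set B := A₀ * p ^ (1 / α) with hB
  have hB0 : 0 < B := mul_pos hA₀ (Real.rpow_pos_of_pos hp0 _)
  have hpos : 0 < Real.exp 1 * B := mul_pos (Real.exp_pos 1) hB0
  have h := meas_ge_le_mul_pow_eLpNorm_enorm (p := ENNReal.ofReal p) G₀
    (by simpa using hp0) ENNReal.ofReal_ne_top (f := fun τ : ℝ => τ) (by fun_prop)
    (ε := ENNReal.ofReal (Real.exp 1 * B)) (by simpa using hpos)
    (fun h => absurd h ENNReal.ofReal_ne_top)
  have hs : {τ : ℝ | ENNReal.ofReal (Real.exp 1 * B) ≤ ‖τ‖ₑ} = {τ | Real.exp 1 * B ≤ |τ|} := by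
    ext τ
    simp only [mem_ofPred_eq, Real.enorm_eq_ofReal_abs]
    rw [ENNReal.ofReal_le_ofReal_iff (abs_nonneg _)]
  rw [hs] at h
  refine h.trans ?_
  rw [ENNReal.toReal_ofReal hp0.le]
  calc _ ≤ (ENNReal.ofReal (Real.exp 1 * B))⁻¹ ^ p * ENNReal.ofReal B ^ p := by
        gcongr
        exact hG.2.2 p hp
    _ = ENNReal.ofReal (Real.exp (-p)) := by
        rw [← ENNReal.ofReal_inv_of_pos hpos, ENNReal.ofReal_rpow_of_pos (inv_pos.2 hpos),
          ENNReal.ofReal_rpow_of_pos hB0, ← ENNReal.ofReal_mul (by positivity),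
          ← Real.mul_rpow (by positivity) hB0.le]
        congr 1
        rw [mul_inv, mul_assoc, inv_mul_cancel₀ hB0.ne', mul_one, ← Real.exp_neg, ← Real.exp_mul]
        ring_nf

theorem measure_abs_ge_le_of_gaussian {Ω : Type*} [MeasurableSpace Ω] {P : Measure Ω}
    [IsProbabilityMeasure P] {Z : Ω → ℝ} (hZm : Measurable Z) {σ : ℝ} (hσ : 0 < σ)
    (hZ : P.map Z = gaussianReal 0 (Real.toNNReal (σ ^ 2))) {p : ℝ} (hp : 0 ≤ p) :
    P {ω | σ * Real.sqrt (2 * p) ≤ |Z ω|} ≤ ENNReal.ofReal (2 * Real.exp (-p)) := by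
  have hsub : HasSubgaussianMGF Z (Real.toNNReal (σ ^ 2)) P := by
    refine ⟨fun t => ?_, fun t => ?_⟩
    · have : Integrable (fun x => Real.exp (t * x)) (P.map Z) := by
        rw [hZ]
        exact integrable_exp_mul_gaussianReal t
      exact this.comp_measurable hZm
    · rw [mgf_gaussianReal hZ t]
      simp
  have hu : 0 ≤ σ * Real.sqrt (2 * p) := by positivity
  have e : -(σ * Real.sqrt (2 * p)) ^ 2 / (2 * (Real.toNNReal (σ ^ 2) : ℝ)) = -p := by
    rw [Real.coe_toNNReal _ (sq_nonneg _), mul_pow, Real.sq_sqrt (by positivity)]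
    field_simp
  have h1 := hsub.measure_ge_le hu
  have h2 := hsub.neg.measure_ge_le hu
  rw [e] at h1 h2
  have hs : {ω | σ * Real.sqrt (2 * p) ≤ |Z ω|} ⊆
      {ω | σ * Real.sqrt (2 * p) ≤ Z ω} ∪ {ω | σ * Real.sqrt (2 * p) ≤ (-Z) ω} := by
    intro ω hω
    rcases le_abs.1 (show σ * Real.sqrt (2 * p) ≤ |_| from hω) with h | h
    · exact Or.inl h
    · exact Or.inr h
  refine (measure_mono hs).trans ((measure_union_le _ _).trans ?_)
  rw [two_mul (Real.exp _), ENNReal.ofReal_add (Real.exp_pos _).le (Real.exp_pos _).le]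
  exact add_le_add ((ENNReal.le_ofReal_iff_toReal_le (measure_ne_top _ _) (Real.exp_pos _).le).2 h1)
    ((ENNReal.le_ofReal_iff_toReal_le (measure_ne_top _ _) (Real.exp_pos _).le).2 h2)

section LocationScale

variable {Ω : Type*} [MeasurableSpace Ω] {P : Measure Ω} {G₀ : Measure ℝ} {A₀ α m s σ : ℝ} {θ Y : Ω → ℝ}

theorem map_sub_const_of_locationScale (hθ : Measurable θ)
    (hlaw : P.map θ = G₀.map (fun τ => m + s * τ)) :
    P.map (fun ω => θ ω - m) = G₀.map (fun τ => s * τ) := by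
  have h1 : P.map (fun ω => θ ω - m) = (P.map θ).map (fun y => y - m) := by
    rw [Measure.map_map (by fun_prop) hθ]
    rfl
  rw [h1, hlaw, Measure.map_map (by fun_prop) (by fun_prop)]
  congr 1
  ext τ
  simp

theorem integral_comp_of_locationScale (hθ : Measurable θ)
    (hlaw : P.map θ = G₀.map (fun τ => m + s * τ)) {g : ℝ → ℝ} (hg : Measurable g) :
    ∫ ω, g (θ ω - m) ∂P = ∫ τ, g (s * τ) ∂G₀ := by
  have h := map_sub_const_of_locationScale hθ hlaw
  rw [← integral_map (φ := fun ω => θ ω - m) (by fun_prop) hg.aestronglyMeasurable, h,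
    integral_map (by fun_prop) hg.aestronglyMeasurable]

theorem memLp_four_signal (hG : MomentControl G₀ A₀ α) (hθ : Measurable θ)
    (hlaw : P.map θ = G₀.map (fun τ => m + s * τ)) : MemLp (fun ω => θ ω - m) 4 P := by
  have h : MemLp (fun y : ℝ => y) 4 (P.map (fun ω => θ ω - m)) := by
    rw [map_sub_const_of_locationScale hθ hlaw, memLp_map_measure_iff (by fun_prop) (by fun_prop)]
    exact hG.memLp_four.const_mul s
  rwa [memLp_map_measure_iff (by fun_prop) (by fun_prop)] at h

theorem memLp_four_noise (hθ : Measurable θ) (hY : Measurable Y)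
    (hZ : P.map (fun ω => Y ω - θ ω) = gaussianReal 0 (Real.toNNReal (σ ^ 2))) :
    MemLp (fun ω => Y ω - θ ω) 4 P := by
  have h : MemLp (fun y : ℝ => y) 4 (P.map (fun ω => Y ω - θ ω)) := by
    rw [hZ]
    exact memLp_id_gaussianReal' 4 (by norm_num)
  rwa [memLp_map_measure_iff (by fun_prop) (by fun_prop)] at h

theorem memLp_four_error (hG : MomentControl G₀ A₀ α) (hθ : Measurable θ) (hY : Measurable Y)
    (hlaw : P.map θ = G₀.map (fun τ => m + s * τ))
    (hZ : P.map (fun ω => Y ω - θ ω) = gaussianReal 0 (Real.toNNReal (σ ^ 2))) :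
    MemLp (fun ω => Y ω - m) 4 P := by
  have h := (memLp_four_signal hG hθ hlaw).add (memLp_four_noise hθ hY hZ)
  refine h.ae_eq (Filter.Eventually.of_forall fun ω => ?_)
  simp

theorem integral_signal (hG : MomentControl G₀ A₀ α) (hθ : Measurable θ)
    (hlaw : P.map θ = G₀.map (fun τ => m + s * τ)) : ∫ ω, (θ ω - m) ∂P = 0 := by
  have := integral_comp_of_locationScale hθ hlaw (g := fun y => y) (by fun_prop)
  rw [this, integral_const_mul, hG.1, mul_zero]

theorem integral_noise (hθ : Measurable θ) (hY : Measurable Y)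
    (hZ : P.map (fun ω => Y ω - θ ω) = gaussianReal 0 (Real.toNNReal (σ ^ 2))) :
    ∫ ω, (Y ω - θ ω) ∂P = 0 := by
  have := integral_map (μ := P) (φ := fun ω => Y ω - θ ω) (f := fun y => y)
    (by fun_prop) (by fun_prop)
  rw [← this, hZ, integral_id_gaussianReal]

theorem integral_error [IsProbabilityMeasure P] (hG : MomentControl G₀ A₀ α) (hθ : Measurable θ) (hY : Measurable Y)
    (hlaw : P.map θ = G₀.map (fun τ => m + s * τ))
    (hZ : P.map (fun ω => Y ω - θ ω) = gaussianReal 0 (Real.toNNReal (σ ^ 2))) :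
    ∫ ω, (Y ω - m) ∂P = 0 := by
  have e : ∀ ω, Y ω - m = (θ ω - m) + (Y ω - θ ω) := fun ω => by ring
  simp only [e]
  rw [integral_add ((memLp_four_signal hG hθ hlaw).integrable (by norm_num))
    ((memLp_four_noise hθ hY hZ).integrable (by norm_num)), integral_signal hG hθ hlaw,
    integral_noise hθ hY hZ, add_zero]

theorem integral_error_sq [IsProbabilityMeasure P] [IsProbabilityMeasure G₀]
    (hG : MomentControl G₀ A₀ α) (hθ : Measurable θ) (hY : Measurable Y)
    (hlaw : P.map θ = G₀.map (fun τ => m + s * τ))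
    (hind : IndepFun θ (fun ω => Y ω - θ ω) P)
    (hZ : P.map (fun ω => Y ω - θ ω) = gaussianReal 0 (Real.toNNReal (σ ^ 2))) :
    ∫ ω, (Y ω - m) ^ 2 ∂P = s ^ 2 + σ ^ 2 := by
  have hind' : IndepFun (fun ω => θ ω - m) (fun ω => Y ω - θ ω) P :=
    hind.comp (φ := fun y => y - m) (ψ := fun y => y) (by fun_prop) (by fun_prop)
  have hU := (memLp_four_signal hG hθ hlaw).mono_exponent (p := 2) (by norm_num)
  have hV := (memLp_four_noise hθ hY hZ).mono_exponent (p := 2) (by norm_num)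
  have hv := hind'.variance_add hU hV
  have e : ((fun ω => θ ω - m) + fun ω => Y ω - θ ω) = fun ω => Y ω - m := by
    ext ω
    simp
  have hvZ : Var[fun ω => Y ω - θ ω; P] = σ ^ 2 := by
    have := variance_map (μ := P) (X := fun y : ℝ => y) (Y := fun ω => Y ω - θ ω)
      (by fun_prop) (by fun_prop)
    rw [hZ] at this
    have h2 := variance_fun_id_gaussianReal (μ := 0) (v := Real.toNNReal (σ ^ 2))
    rw [h2, Real.coe_toNNReal _ (sq_nonneg _)] at this
    exact this.symm
  rw [e, variance_of_integral_eq_zero (by fun_prop) (integral_error hG hθ hY hlaw hZ),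
    variance_of_integral_eq_zero (by fun_prop) (integral_signal hG hθ hlaw), hvZ,
    integral_comp_of_locationScale hθ hlaw (g := fun y => y ^ 2) (by fun_prop)] at hv
  rw [hv]
  congr 1
  simp only [mul_pow]
  rw [integral_const_mul, hG.integral_sq, mul_one]

theorem integral_error_pow_four_le [IsProbabilityMeasure P] (hA₀ : 0 < A₀) (hG : MomentControl G₀ A₀ α)
    (hθ : Measurable θ) (hY : Measurable Y) (hlaw : P.map θ = G₀.map (fun τ => m + s * τ))
    (hZ : P.map (fun ω => Y ω - θ ω) = gaussianReal 0 (Real.toNNReal (σ ^ 2))) :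
    ∫ ω, (Y ω - m) ^ 4 ∂P ≤
      8 * (s ^ 4 * (A₀ * 4 ^ (1 / α)) ^ 4 + σ ^ 4 * gaussianFourthMoment) := by
  have hint : ∀ {f : Ω → ℝ}, MemLp f 4 P → Integrable (fun ω => f ω ^ 4) P := fun {f} hf => by
    have := hf.integrable_norm_pow (p := 4) (by norm_num)
    refine this.congr (Filter.Eventually.of_forall fun ω => ?_)
    simp only [Real.norm_eq_abs]
    exact Even.pow_abs (by decide) _
  have hU := hint (memLp_four_signal hG hθ hlaw)
  have hV := hint (memLp_four_noise hθ hY hZ)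
  have hE := hint (memLp_four_error hG hθ hY hlaw hZ)
  calc _ ≤ ∫ ω, 8 * ((θ ω - m) ^ 4 + (Y ω - θ ω) ^ 4) ∂P := by
        refine integral_mono hE ((hU.add hV).const_mul 8) fun ω => ?_
        have e : Y ω - m = (θ ω - m) + (Y ω - θ ω) := by ring
        simp only [e]
        generalize θ ω - m = x
        generalize Y ω - θ ω = y
        have h1 : (x + y) ^ 2 ≤ 2 * (x ^ 2 + y ^ 2) := by nlinarith [sq_nonneg (x - y)]
        have h2 : ((x + y) ^ 2) ^ 2 ≤ (2 * (x ^ 2 + y ^ 2)) ^ 2 :=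
          pow_le_pow_left₀ (sq_nonneg _) h1 2
        nlinarith [sq_nonneg (x ^ 2 - y ^ 2)]
    _ = 8 * (s ^ 4 * ∫ τ, τ ^ 4 ∂G₀ + σ ^ 4 * gaussianFourthMoment) := by
        rw [integral_const_mul, integral_add hU hV,
          integral_comp_of_locationScale hθ hlaw (g := fun y => y ^ 4) (by fun_prop),
          ← integral_pow_four_gaussianReal, ← hZ, integral_map (by fun_prop) (by fun_prop)]
        simp only [mul_pow]
        rw [integral_const_mul]
    _ ≤ _ := by
        gcongr
        exact hG.integral_pow_four_le hA₀

theorem measure_abs_error_gt_le [IsProbabilityMeasure P] (hA₀ : 0 < A₀) (hs : 0 < s) (hσ : 0 < σ)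
    (hG : MomentControl G₀ A₀ α) (hθ : Measurable θ) (hY : Measurable Y)
    (hlaw : P.map θ = G₀.map (fun τ => m + s * τ))
    (hZ : P.map (fun ω => Y ω - θ ω) = gaussianReal 0 (Real.toNNReal (σ ^ 2))) {p M : ℝ}
    (hp : 1 ≤ p)
    (hM : s * (Real.exp 1 * (A₀ * p ^ (1 / α))) + σ * Real.sqrt (2 * p) ≤ M) :
    P {ω | M < |Y ω - m|} ≤ ENNReal.ofReal (3 * Real.exp (-p)) := by
  have h1 : P {ω | s * (Real.exp 1 * (A₀ * p ^ (1 / α))) ≤ |θ ω - m|} ≤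
      ENNReal.ofReal (Real.exp (-p)) := by
    have hms : MeasurableSet {y : ℝ | s * (Real.exp 1 * (A₀ * p ^ (1 / α))) ≤ |y|} :=
      measurableSet_le measurable_const (by fun_prop)
    have e := Measure.map_apply (μ := P) (f := fun ω => θ ω - m) (by fun_prop) hms
    rw [map_sub_const_of_locationScale hθ hlaw, Measure.map_apply (by fun_prop) hms] at e
    have e2 : (fun τ => s * τ) ⁻¹' {y : ℝ | s * (Real.exp 1 * (A₀ * p ^ (1 / α))) ≤ |y|} =
        {τ | Real.exp 1 * (A₀ * p ^ (1 / α)) ≤ |τ|} := by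
      ext τ
      simp only [mem_preimage, mem_ofPred_eq, abs_mul, abs_of_pos hs]
      exact mul_le_mul_iff_right₀ hs
    rw [e2] at e
    exact e.symm.le.trans (hG.measure_ge_le hA₀ hp)
  have h2 := measure_abs_ge_le_of_gaussian (by fun_prop) hσ hZ (p := p) (by linarith)
  have hsub : {ω | M < |Y ω - m|} ⊆ {ω | s * (Real.exp 1 * (A₀ * p ^ (1 / α))) ≤ |θ ω - m|} ∪
      {ω | σ * Real.sqrt (2 * p) ≤ |Y ω - θ ω|} := by
    intro ω hω
    by_contra hc
    simp only [mem_union, mem_ofPred_eq, not_or, not_le] at hc hω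
    have : |Y ω - m| ≤ |Y ω - θ ω| + |θ ω - m| := abs_sub_le _ _ _
    linarith [hc.1, hc.2]
  refine (measure_mono hsub).trans ((measure_union_le _ _).trans ((add_le_add h1 h2).trans ?_))
  rw [← ENNReal.ofReal_add (Real.exp_pos _).le (by positivity)]
  apply le_of_eq
  congr 1
  ring

end LocationScale

/-! ### Bandwidths of order `n^{-1/5}` -/

section Bandwidth

variable {n : ℕ} {Ch h : ℝ}

theorem pos_of_mem_bandwidthSet (hn : 0 < n) (hh : h ∈ bandwidthSet Ch n) : 0 < h := by
  have hn' : (0 : ℝ) < n := by exact_mod_cast hn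
  exact lt_of_lt_of_le (by positivity) ((le_max_right _ _).trans hh.1)

theorem one_div_le_of_mem_bandwidthSet (hh : h ∈ bandwidthSet Ch n) : 1 / (n : ℝ) ≤ 2 * h := by
  have h1 := (le_max_right _ _).trans hh.1
  have h2 : 1 / (n : ℝ) = 2 * (1 / (2 * (n : ℝ))) := by ring
  rw [h2]
  linarith

theorem sq_le_of_mem_bandwidthSet (hn : 0 < n) (hh : h ∈ bandwidthSet Ch n) :
    h ^ 2 ≤ Ch ^ 2 * (n : ℝ) ^ (-(2 / 5) : ℝ) := by
  have hn' : (0 : ℝ) < n := by exact_mod_cast hn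
  have h1 := pow_le_pow_left₀ (pos_of_mem_bandwidthSet hn hh).le hh.2 2
  rw [mul_pow, ← Real.rpow_natCast ((n : ℝ) ^ _), ← Real.rpow_mul hn'.le] at h1
  norm_num at h1 ⊢
  exact h1

theorem natCast_mul_le_of_mem_bandwidthSet (hn : 0 < n) (hh : h ∈ bandwidthSet Ch n) :
    n * h ≤ Ch * (n : ℝ) ^ (4 / 5 : ℝ) := by
  have hn' : (0 : ℝ) < n := by exact_mod_cast hn
  have e : (n : ℝ) ^ (4 / 5 : ℝ) = n * (n : ℝ) ^ (-(1 / 5) : ℝ) := by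
    rw [← Real.rpow_one_add' hn'.le (by norm_num)]
    norm_num
  rw [e]
  calc n * h ≤ n * (Ch * (n : ℝ) ^ (-(1 / 5) : ℝ)) := mul_le_mul_of_nonneg_left hh.2 hn'.le
    _ = _ := by ring

theorem rpow_div_le_of_mem_bandwidthSet (hn : 0 < n) (hCh : 1 < Ch) (hh : h ∈ bandwidthSet Ch n) :
    (n : ℝ) ^ (2 / 5 : ℝ) / (n * h) ≤ Ch * (n : ℝ) ^ (-(2 / 5) : ℝ) := by
  have hn' : (0 : ℝ) < n := by exact_mod_cast hn
  have hC : 0 < Ch := by linarith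
  have hh0 := pos_of_mem_bandwidthSet hn hh
  have h1 : Ch⁻¹ * (n : ℝ) ^ (-(1 / 5) : ℝ) ≤ h := (le_max_left _ _).trans hh.1
  rw [div_le_iff₀ (by positivity)]
  have e : (n : ℝ) ^ (2 / 5 : ℝ) =
      Ch * (n : ℝ) ^ (-(2 / 5) : ℝ) * (n * (Ch⁻¹ * (n : ℝ) ^ (-(1 / 5) : ℝ))) := by
    have : (n : ℝ) ^ (2 / 5 : ℝ) =
        (n : ℝ) ^ (-(2 / 5) : ℝ) * ((n : ℝ) ^ (1 : ℝ) * (n : ℝ) ^ (-(1 / 5) : ℝ)) := by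
      rw [← Real.rpow_add hn', ← Real.rpow_add hn']
      norm_num
    rw [this, Real.rpow_one]
    field_simp
  calc (n : ℝ) ^ (2 / 5 : ℝ) =
      Ch * (n : ℝ) ^ (-(2 / 5) : ℝ) * (n * (Ch⁻¹ * (n : ℝ) ^ (-(1 / 5) : ℝ))) := e
    _ ≤ _ := by gcongr

/-- Projected bandwidths are in `H_n` as soon as `1 / (2n)` is below the lower end of the range to
which they are projected. -/
theorem projBandwidth_mem_bandwidthSet (hn : 0 < n) (hCh : 1 < Ch)
    (hlarge : Ch / 2 ≤ (n : ℝ) ^ (4 / 5 : ℝ)) (h : ℝ) :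
    projBandwidth Ch n h ∈ bandwidthSet Ch n := by
  have hn' : (0 : ℝ) < n := by exact_mod_cast hn
  have hC : 0 < Ch := by linarith
  have hle : Ch⁻¹ * (n : ℝ) ^ (-(1 / 5) : ℝ) ≤ Ch * (n : ℝ) ^ (-(1 / 5) : ℝ) := by
    gcongr
    exact (inv_le_one_of_one_le₀ hCh.le).trans hCh.le
  have h1 : 1 / (2 * (n : ℝ)) ≤ Ch⁻¹ * (n : ℝ) ^ (-(1 / 5) : ℝ) := by
    have e : (n : ℝ) ^ (4 / 5 : ℝ) = n * (n : ℝ) ^ (-(1 / 5) : ℝ) := by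
      rw [← Real.rpow_one_add' hn'.le (by norm_num)]
      norm_num
    rw [e] at hlarge
    rw [inv_mul_eq_div, div_le_div_iff₀ (by positivity) hC]
    linarith
  refine ⟨?_, min_le_right _ _⟩
  rw [max_eq_left h1]
  exact le_min (le_max_right _ _) hle

end Bandwidth

/-! ### Deterministic error bounds -/

theorem localLinear_add {n : ℕ} (K : ℝ → ℝ) (X : Fin n → ℝ) (h : ℝ) (y z : Fin n → ℝ) (x : ℝ) :
    localLinear K X h (fun i => y i + z i) x = localLinear K X h y x + localLinear K X h z x := by
  simp only [localLinear, mul_add, Finset.sum_add_distrib]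

theorem abs_localLinear_le {n : ℕ} {K : ℝ → ℝ} {X : Fin n → ℝ} {h x Λ B : ℝ} {y : Fin n → ℝ}
    (hB : 0 ≤ B) (hΛ : ∑ i, |llrWeight K X h i x| ≤ Λ) (hy : ∀ i, |y i| ≤ B) :
    |localLinear K X h y x| ≤ Λ * B := by
  calc _ ≤ ∑ i, |llrWeight K X h i x| * B := by
        refine (Finset.abs_sum_le_sum_abs _ _).trans (Finset.sum_le_sum fun i _ => ?_)
        rw [abs_mul]
        exact mul_le_mul_of_nonneg_left (hy i) (abs_nonneg _)
    _ ≤ _ := by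
        rw [← Finset.sum_mul]
        gcongr

theorem abs_sqrt_sub_le {a b : ℝ} (hb : 0 < b) : |Real.sqrt a - b| ≤ |a - b ^ 2| / b := by
  rw [le_div_iff₀ hb]
  rcases le_or_gt 0 a with ha | ha
  · have h1 : a - b ^ 2 = (Real.sqrt a - b) * (Real.sqrt a + b) := by
      nlinarith [Real.sq_sqrt ha]
    have h2 := Real.sqrt_nonneg a
    rw [h1, abs_mul, abs_of_pos (show 0 < Real.sqrt a + b by linarith)]
    exact mul_le_mul_of_nonneg_left (by linarith) (abs_nonneg _)
  · rw [Real.sqrt_eq_zero_of_nonpos ha.le, zero_sub, abs_neg, abs_of_pos hb,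
      abs_of_neg (by nlinarith)]
    nlinarith

section Design

variable {n n₀ : ℕ} {K : ℝ → ℝ} {X : Fin n → ℝ} {Ch lam₀ a₀ c₁ c₂ K₀ CK VK : ℝ}

theorem RegularDesign.sum_abs_llrWeight_le (hX : RegularDesign K Ch n₀ lam₀ a₀ c₁ c₂ X)
    (hK : RegularKernel K Ch K₀ CK VK) (hn : 0 < n) (hn₀ : n₀ ≤ n) (ha₀ : 0 < a₀) (hK₀ : 0 < K₀)
    (hlam : 0 < lam₀) {h x : ℝ} (hh : h ∈ bandwidthSet Ch n) (hx : x ∈ Icc (0 : ℝ) 1) :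
    ∑ i, |llrWeight K X h i x| ≤ 4 * a₀ * K₀ / lam₀ :=
  _root_.sum_abs_llrWeight_le hn ha₀ hK₀.le hlam (pos_of_mem_bandwidthSet hn hh)
    (one_div_le_of_mem_bandwidthSet hh) hX.1 hX.2.2.1 hK.1 hK.2.1 (hX.2.1 hn₀ x hx h hh)

theorem RegularDesign.abs_bias_le (hX : RegularDesign K Ch n₀ lam₀ a₀ c₁ c₂ X)
    (hK : RegularKernel K Ch K₀ CK VK) (hn : 0 < n) (hn₀ : n₀ ≤ n) (ha₀ : 0 < a₀) (hK₀ : 0 < K₀)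
    (hlam : 0 < lam₀) {h x : ℝ} (hh : h ∈ bandwidthSet Ch n) (hx : x ∈ Icc (0 : ℝ) 1)
    {f : ℝ → ℝ} {H : ℝ} (hH : 0 ≤ H)
    (hf : ∃ d : ℝ, ∀ y ∈ Icc (0 : ℝ) 1, |f y - f x - d * (y - x)| ≤ H * (y - x) ^ 2) :
    |localLinear K X h (fun i => f (X i)) x - f x| ≤
      4 * a₀ * K₀ / lam₀ * (H * Ch ^ 2) * (n : ℝ) ^ (-(2 / 5) : ℝ) := by
  obtain ⟨d, hd⟩ := hf
  have h1 := abs_localLinear_sub_le (pos_of_mem_bandwidthSet hn hh) hK.1 hH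
    (isUnit_det_llrMatrix hlam (hX.2.1 hn₀ x hx h hh))
    (hX.sum_abs_llrWeight_le hK hn hn₀ ha₀ hK₀ hlam hh hx) (fun i => hd (X i) (hX.1 i))
  refine h1.trans ?_
  calc _ ≤ 4 * a₀ * K₀ / lam₀ * (H * (Ch ^ 2 * (n : ℝ) ^ (-(2 / 5) : ℝ))) := by
        gcongr
        exact sq_le_of_mem_bandwidthSet hn hh
    _ = _ := by ring

theorem RegularDesign.abs_noise_le (hX : RegularDesign K Ch n₀ lam₀ a₀ c₁ c₂ X)
    (hn : 0 < n) (hn₀ : n₀ ≤ n) (hCh : 1 < Ch) (hlam : 0 < lam₀) {h x : ℝ}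
    (hh : h ∈ bandwidthSet Ch n) (hx : x ∈ Icc (0 : ℝ) 1) {ξ : Fin n → ℝ} {τ : ℝ} (hτ : 0 ≤ τ)
    (hξ : ∀ k, k = 1 ∨ k = 2 → ∀ f ∈ kernelClass K Ch n k,
      |∑ i, f (X i) * ξ i| ≤ τ * (n : ℝ) ^ (2 / 5 : ℝ)) :
    |localLinear K X h ξ x| ≤ 2 / lam₀ * (Ch * τ) * (n : ℝ) ^ (-(2 / 5) : ℝ) := by
  have h1 := hξ 1 (Or.inl rfl) _ ⟨x, hx, h, hh, rfl⟩
  have h2 := hξ 2 (Or.inr rfl) _ ⟨x, hx, h, hh, rfl⟩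
  simp only [Nat.sub_self, pow_zero, one_mul] at h1
  simp only [Nat.add_one_sub_one, pow_one] at h2
  refine (abs_localLinear_le_of_kernel_sums hn (pos_of_mem_bandwidthSet hn hh) hlam
    (hX.2.1 hn₀ x hx h hh) ξ h1 h2).trans ?_
  calc _ = 2 / lam₀ * τ * ((n : ℝ) ^ (2 / 5 : ℝ) / (n * h)) := by ring
    _ ≤ 2 / lam₀ * τ * (Ch * (n : ℝ) ^ (-(2 / 5) : ℝ)) := by
        gcongr
        exact rpow_div_le_of_mem_bandwidthSet hn hCh hh
    _ = _ := by ring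

/-- The error of the projected estimate of the mean. -/
theorem RegularDesign.abs_mean_sub_le (hX : RegularDesign K Ch n₀ lam₀ a₀ c₁ c₂ X)
    (hK : RegularKernel K Ch K₀ CK VK) (hn : 0 < n) (hn₀ : n₀ ≤ n) (hCh : 1 < Ch) (ha₀ : 0 < a₀)
    (hK₀ : 0 < K₀) (hlam : 0 < lam₀) {h : ℝ} (hh : h ∈ bandwidthSet Ch n)
    {A τ : ℝ} (hA : 0 ≤ A) (hτ : 0 ≤ τ) {μ mHat : ℝ → ℝ} {y : Fin n → ℝ}
    (hμ : μ ∈ HolderClass2 A 0 1) (hm : IsSupProj (HolderClass2 A 0 1) (localLinear K X h y) mHat)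
    (hξ : ∀ k, k = 1 ∨ k = 2 → ∀ f ∈ kernelClass K Ch n k,
      |∑ i, f (X i) * (y i - μ (X i))| ≤ τ * (n : ℝ) ^ (2 / 5 : ℝ))
    {x : ℝ} (hx : x ∈ Icc (0 : ℝ) 1) :
    |mHat x - μ x| ≤ 2 * (4 * a₀ * K₀ / lam₀ * (A * Ch ^ 2) + 2 / lam₀ * (Ch * τ)) *
      (n : ℝ) ^ (-(2 / 5) : ℝ) := by
  have hC : 0 < Ch := by linarith
  have := hm.abs_sub_le hμ (r := (4 * a₀ * K₀ / lam₀ * (A * Ch ^ 2) + 2 / lam₀ * (Ch * τ)) *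
      (n : ℝ) ^ (-(2 / 5) : ℝ)) (by positivity) (fun x hx => ?_) hx
  · rwa [← mul_assoc] at this
  have e := localLinear_add K X h (fun i => μ (X i)) (fun i => y i - μ (X i)) x
  simp only [add_sub_cancel] at e
  have h1 := hX.abs_bias_le hK hn hn₀ ha₀ hK₀ hlam hh hx hA (HolderClass2.exists_taylor hA hμ x hx)
  have h2 := hX.abs_noise_le hn hn₀ hCh hlam hh hx hτ hξ
  have e' : localLinear K X h y x - μ x =
      (localLinear K X h (fun i => μ (X i)) x - μ x) +
        localLinear K X h (fun i => y i - μ (X i)) x := by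
    rw [← add_sub_right_comm, ← e]
  rw [e', add_mul]
  exact (abs_add_le _ _).trans (add_le_add h1 h2)

/-- The error of the local linear regression of the squared residuals. The residuals differ from
the errors `ε` by at most `δ`, and the cross term between the two is bounded by the maximum of the
errors times `δ`. -/
theorem RegularDesign.abs_variance_sub_le (hX : RegularDesign K Ch n₀ lam₀ a₀ c₁ c₂ X)
    (hK : RegularKernel K Ch K₀ CK VK) (hn : 0 < n) (hn₀ : n₀ ≤ n) (hCh : 1 < Ch) (ha₀ : 0 < a₀)
    (hK₀ : 0 < K₀) (hlam : 0 < lam₀) {h : ℝ} (hh : h ∈ bandwidthSet Ch n)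
    {H τ M δ : ℝ} (hH : 0 ≤ H) (hτ : 0 ≤ τ) (hM : 0 ≤ M) (hδ : 0 ≤ δ) {v : ℝ → ℝ}
    {ε R : Fin n → ℝ} {x : ℝ} (hx : x ∈ Icc (0 : ℝ) 1)
    (hv : ∃ d : ℝ, ∀ y ∈ Icc (0 : ℝ) 1, |v y - v x - d * (y - x)| ≤ H * (y - x) ^ 2)
    (hξ : ∀ k, k = 1 ∨ k = 2 → ∀ f ∈ kernelClass K Ch n k,
      |∑ i, f (X i) * (ε i ^ 2 - v (X i))| ≤ τ * (n : ℝ) ^ (2 / 5 : ℝ))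
    (hε : ∀ i, |ε i| ≤ M) (hR : ∀ i, |R i - ε i| ≤ δ) :
    |localLinear K X h (fun i => R i ^ 2) x - v x| ≤
      (4 * a₀ * K₀ / lam₀ * (H * Ch ^ 2) + 2 / lam₀ * (Ch * τ)) * (n : ℝ) ^ (-(2 / 5) : ℝ) +
        4 * a₀ * K₀ / lam₀ * (2 * M * δ + δ ^ 2) := by
  have e1 := localLinear_add K X h (fun i => v (X i) + (ε i ^ 2 - v (X i)))
    (fun i => R i ^ 2 - ε i ^ 2) x
  have e2 := localLinear_add K X h (fun i => v (X i)) (fun i => ε i ^ 2 - v (X i)) x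
  rw [e2] at e1
  simp only [add_sub_cancel] at e1
  have h1 := hX.abs_bias_le hK hn hn₀ ha₀ hK₀ hlam hh hx hH hv
  have h2 := hX.abs_noise_le hn hn₀ hCh hlam hh hx hτ hξ
  have h3 : |localLinear K X h (fun i => R i ^ 2 - ε i ^ 2) x| ≤
      4 * a₀ * K₀ / lam₀ * (2 * M * δ + δ ^ 2) := by
    refine abs_localLinear_le (by positivity)
      (hX.sum_abs_llrWeight_le hK hn hn₀ ha₀ hK₀ hlam hh hx) fun i => ?_
    have e : R i ^ 2 - ε i ^ 2 = 2 * (ε i * (R i - ε i)) + (R i - ε i) ^ 2 := by ring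
    rw [e]
    refine (abs_add_le _ _).trans ?_
    rw [abs_mul, abs_two, abs_mul, abs_pow]
    calc _ ≤ 2 * (M * δ) + δ ^ 2 := by
          gcongr
          · exact hε i
          · exact hR i
          · exact hR i
      _ = _ := by ring
  rw [e1, add_mul]
  have e' : localLinear K X h (fun i => v (X i)) x + localLinear K X h (fun i => ε i ^ 2 - v (X i)) x +
      localLinear K X h (fun i => R i ^ 2 - ε i ^ 2) x - v x =
      (localLinear K X h (fun i => v (X i)) x - v x) +
        localLinear K X h (fun i => ε i ^ 2 - v (X i)) x +
        localLinear K X h (fun i => R i ^ 2 - ε i ^ 2) x := by ring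
  rw [e']
  exact (abs_add_three _ _ _).trans (add_le_add (add_le_add h1 h2) h3)

/-- The error of the truncated estimate of the scale, in terms of that of the variance. -/
theorem RegularDesign.abs_sRaw_sub_le (hX : RegularDesign K Ch n₀ lam₀ a₀ c₁ c₂ X)
    (hn : 0 < n) (hn₀ : n₀ ≤ n) (hc₁ : 0 < c₁) {h : ℝ} (hh : h ∈ bandwidthSet Ch n)
    {a b sl s V r x : ℝ} {R2 : Fin n → ℝ} (hsl : 0 < sl) (hs : sl ≤ s)
    (hV : s ^ 2 + sigmaFn a b x ^ 2 ≤ V)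
    (hr : |localLinear K X h R2 x - (s ^ 2 + sigmaFn a b x ^ 2)| ≤ r) :
    |sRaw K X h a b R2 x - s| ≤
      r / sl + Real.sqrt (2 / c₁) * (n : ℝ) ^ (-(2 / 5) : ℝ) * (1 + V + r) := by
  have hn' : (0 : ℝ) < n := by exact_mod_cast hn
  have hp := (hX.2.2.2 hn₀ h hh).1
  have hs0 : 0 < s := hsl.trans_le hs
  have hr0 : 0 ≤ r := (abs_nonneg _).trans hr
  set v := localLinear K X h R2 x with hv
  have h1 : |Real.sqrt (v - sigmaFn a b x ^ 2) - s| ≤ r / sl := by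
    refine (abs_sqrt_sub_le hs0).trans ?_
    have e : v - sigmaFn a b x ^ 2 - s ^ 2 = v - (s ^ 2 + sigmaFn a b x ^ 2) := by ring
    rw [e]
    gcongr
  have hpos : 0 < c₁ * (n : ℝ) ^ (4 / 5 : ℝ) := by positivity
  have h2 : Real.sqrt (2 / (effSampleSize K X h + 2)) ≤
      Real.sqrt (2 / c₁) * (n : ℝ) ^ (-(2 / 5) : ℝ) := by
    have e : Real.sqrt (2 / c₁) * (n : ℝ) ^ (-(2 / 5) : ℝ) =
        Real.sqrt (2 / (c₁ * (n : ℝ) ^ (4 / 5 : ℝ))) := by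
      rw [← div_div, Real.sqrt_div (show 0 ≤ 2 / c₁ by positivity),
        Real.sqrt_eq_rpow ((n : ℝ) ^ (4 / 5 : ℝ)),
        ← Real.rpow_mul hn'.le, Real.rpow_neg hn'.le, ← div_eq_mul_inv]
      norm_num
    rw [e]
    refine Real.sqrt_le_sqrt ?_
    gcongr
    linarith
  have hV0 : 0 ≤ V := le_trans (by positivity) hV
  have h3 : Real.sqrt v ≤ 1 + V + r := by
    rw [Real.sqrt_le_left (by linarith)]
    have := (abs_le.1 hr).2
    nlinarith
  have h4 : Real.sqrt (2 / (effSampleSize K X h + 2) * v) ≤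
      Real.sqrt (2 / c₁) * (n : ℝ) ^ (-(2 / 5) : ℝ) * (1 + V + r) := by
    rw [Real.sqrt_mul (div_nonneg (by norm_num)
      (by linarith [effSampleSize_nonneg K X h]))]
    exact mul_le_mul h2 h3 (Real.sqrt_nonneg _) (by positivity)
  have h5 : 0 ≤ Real.sqrt (2 / c₁) * (n : ℝ) ^ (-(2 / 5) : ℝ) * (1 + V + r) :=
    (Real.sqrt_nonneg _).trans h4
  have h6 : 0 ≤ r / sl := by positivity
  unfold sRaw
  rw [← hv]
  rw [abs_le] at h1 ⊢
  refine ⟨?_, ?_⟩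
  · linarith [le_max_left (Real.sqrt (v - sigmaFn a b x ^ 2))
      (Real.sqrt (2 / (effSampleSize K X h + 2) * v))]
  · rw [sub_le_iff_le_add]
    exact max_le (by linarith) (by linarith)

theorem varFloor_le (hX : RegularDesign K Ch n₀ lam₀ a₀ c₁ c₂ X) (hn : 0 < n) (hn₀ : n₀ ≤ n)
    (hc₁ : 0 < c₁) {h : ℝ} (hh : h ∈ bandwidthSet Ch n) {a b σl σu : ℝ}
    (hσ : ∀ x ∈ Icc (0 : ℝ) 1, sigmaFn a b x ∈ Icc σl σu) :
    varFloor K X h a b ≤ 2 * σu ^ 2 / (c₁ * (n : ℝ) ^ (4 / 5 : ℝ)) := by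
  have hn' : (0 : ℝ) < n := by exact_mod_cast hn
  have hp := (hX.2.2.2 hn₀ h hh).1
  have hpos : 0 < c₁ * (n : ℝ) ^ (4 / 5 : ℝ) := by positivity
  have hi : (⨅ i, sigmaFn a b (X i) ^ 2) ≤ σu ^ 2 := by
    refine (ciInf_le ⟨0, ?_⟩ ⟨0, hn⟩).trans ?_
    · rintro _ ⟨i, rfl⟩
      positivity
    · exact pow_le_pow_left₀ (sigmaFn_pos _ _ _).le (hσ _ (hX.1 _)).2 2
  have hi0 : 0 ≤ ⨅ i, sigmaFn a b (X i) ^ 2 := Real.iInf_nonneg fun i => sq_nonneg _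
  unfold varFloor
  calc _ ≤ 2 / (c₁ * (n : ℝ) ^ (4 / 5 : ℝ)) * σu ^ 2 := by
        gcongr
        linarith
    _ = _ := by ring

end Design

/-- The variance floor is at least of order `1 / n`, because the effective sample size is at most
`n`. -/
theorem le_varFloor {n : ℕ} (hn : 0 < n) (K : ℝ → ℝ) {X : Fin n → ℝ} (h : ℝ) {a b σl : ℝ}
    (hσl : 0 < σl) (hσ : ∀ i, σl ≤ sigmaFn a b (X i)) :
    2 / ((n : ℝ) + 2) * σl ^ 2 ≤ varFloor K X h a b := by
  have : Nonempty (Fin n) := ⟨⟨0, hn⟩⟩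
  have h1 := effSampleSize_le hn K X h
  have h0 := effSampleSize_nonneg K X h
  unfold varFloor
  have hi : σl ^ 2 ≤ ⨅ i, sigmaFn a b (X i) ^ 2 :=
    le_ciInf fun i => pow_le_pow_left₀ hσl.le (hσ i) 2
  gcongr

/-- Error bounds for one sample on which the errors and their kernel sums are well behaved. The
number `L ≥ 1` carries the logarithmic factor. -/
theorem RegularDesign.estimation_error_le {n n₀ : ℕ} {K : ℝ → ℝ} {X : Fin n → ℝ}
    {Ch lam₀ a₀ c₁ c₂ K₀ CK VK : ℝ} (hX : RegularDesign K Ch n₀ lam₀ a₀ c₁ c₂ X)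
    (hK : RegularKernel K Ch K₀ CK VK) (hn : 0 < n) (hn₀ : n₀ ≤ n) (hCh : 1 < Ch) (ha₀ : 0 < a₀)
    (hK₀ : 0 < K₀) (hlam : 0 < lam₀) (hc₁ : 0 < c₁)
    (hlarge : Ch / 2 ≤ (n : ℝ) ^ (4 / 5 : ℝ))
    {a b σl σu sl A H V t₁ t₂ M₁ L : ℝ} (hσ : ∀ x ∈ Icc (0 : ℝ) 1, sigmaFn a b x ∈ Icc σl σu)
    (hsl : 0 < sl) (hfloor : 2 * σu ^ 2 / (c₁ * (n : ℝ) ^ (4 / 5 : ℝ)) ≤ sl ^ 2)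
    (hA : 0 ≤ A) (hH : 0 ≤ H) (ht₁ : 0 ≤ t₁) (ht₂ : 0 ≤ t₂) (hM₁ : 0 ≤ M₁) (hL : 1 ≤ L)
    {μ s mHat sHat : ℝ → ℝ} {y : Fin n → ℝ} {hm hs Λ d₁ r : ℝ}
    (hμ : μ ∈ HolderClass2 A 0 1) (hsA : s ∈ HolderClass2 A 0 1)
    (hs0 : ∀ x ∈ Icc (0 : ℝ) 1, sl ≤ s x)
    (hV : ∀ x ∈ Icc (0 : ℝ) 1, s x ^ 2 + sigmaFn a b x ^ 2 ≤ V)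
    (hv : ∀ x ∈ Icc (0 : ℝ) 1, ∃ d : ℝ, ∀ y ∈ Icc (0 : ℝ) 1,
      |(s y ^ 2 + sigmaFn a b y ^ 2) - (s x ^ 2 + sigmaFn a b x ^ 2) - d * (y - x)| ≤
        H * (y - x) ^ 2)
    (hest : IsLLREstimate K Ch A a b X y hm hs mHat sHat)
    (hε : ∀ i, |y i - μ (X i)| ≤ M₁ * L)
    (hξ₁ : ∀ k, k = 1 ∨ k = 2 → ∀ f ∈ kernelClass K Ch n k,
      |∑ i, f (X i) * (y i - μ (X i))| ≤ t₁ * L * (n : ℝ) ^ (2 / 5 : ℝ))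
    (hξ₂ : ∀ k, k = 1 ∨ k = 2 → ∀ f ∈ kernelClass K Ch n k,
      |∑ i, f (X i) * ((y i - μ (X i)) ^ 2 - (s (X i) ^ 2 + sigmaFn a b (X i) ^ 2))| ≤
        t₂ * L ^ 2 * (n : ℝ) ^ (2 / 5 : ℝ))
    (hΛ : Λ = 4 * a₀ * K₀ / lam₀)
    (hd₁ : d₁ = 2 * (Λ * (A * Ch ^ 2) + 2 / lam₀ * (Ch * t₁)))
    (hr : r = Λ * (H * Ch ^ 2) + 2 / lam₀ * (Ch * t₂) + Λ * (2 * M₁ * d₁ + d₁ ^ 2))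
    {x : ℝ} (hx : x ∈ Icc (0 : ℝ) 1) :
    |mHat x - μ x| ≤ d₁ * (n : ℝ) ^ (-(2 / 5) : ℝ) * L ∧
    |sHat x - s x| ≤
      2 * (r / sl + Real.sqrt (2 / c₁) * (1 + V + r)) * (n : ℝ) ^ (-(2 / 5) : ℝ) * L ^ 2 := by
  have hn1 : (1 : ℝ) ≤ n := by exact_mod_cast hn
  have hC : 0 < Ch := by linarith
  have hL0 : 0 ≤ L := by linarith
  have hL2 : L ≤ L ^ 2 := by nlinarith
  have hL3 : 1 ≤ L ^ 2 := hL.trans hL2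
  have hΛ0 : 0 ≤ Λ := by rw [hΛ]; positivity
  have hd0 : 0 ≤ d₁ := by rw [hd₁]; positivity
  have hr0 : 0 ≤ r := by rw [hr]; positivity
  have hV0 : 0 ≤ V := le_trans (by positivity) (hV x hx)
  set ρ := (n : ℝ) ^ (-(2 / 5) : ℝ) with hρ
  have hρ0 : 0 ≤ ρ := by positivity
  have hρ1 : ρ ≤ 1 := Real.rpow_le_one_of_one_le_of_nonpos hn1 (by norm_num)
  have hbm := projBandwidth_mem_bandwidthSet hn hCh hlarge hm
  have hbs := projBandwidth_mem_bandwidthSet hn hCh hlarge hs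
  have hmean : ∀ x ∈ Icc (0 : ℝ) 1, |mHat x - μ x| ≤ d₁ * ρ * L := by
    intro x hx
    refine (hX.abs_mean_sub_le hK hn hn₀ hCh ha₀ hK₀ hlam hbm hA (mul_nonneg ht₁ hL0) hμ hest.1
      hξ₁ hx).trans ?_
    rw [← hΛ, ← hρ]
    have : Λ * (A * Ch ^ 2) ≤ Λ * (A * Ch ^ 2) * L := le_mul_of_one_le_right (by positivity) hL
    calc _ ≤ 2 * (Λ * (A * Ch ^ 2) * L + 2 / lam₀ * (Ch * (t₁ * L))) * ρ := by gcongr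
      _ = _ := by
          rw [hd₁]
          ring
  refine ⟨hmean x hx, ?_⟩
  have hvar : ∀ x ∈ Icc (0 : ℝ) 1,
      |localLinear K X (projBandwidth Ch n hs) (fun i => (y i - mHat (X i)) ^ 2) x -
        (s x ^ 2 + sigmaFn a b x ^ 2)| ≤ r * ρ * L ^ 2 := by
    intro x hx
    refine (hX.abs_variance_sub_le (v := fun x => s x ^ 2 + sigmaFn a b x ^ 2)
      (ε := fun i => y i - μ (X i)) (δ := d₁ * ρ * L) hK hn hn₀ hCh ha₀ hK₀ hlam hbs hH
      (mul_nonneg ht₂ (sq_nonneg L)) (mul_nonneg hM₁ hL0) (by positivity) hx (hv x hx) hξ₂ hε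
      fun i => ?_).trans ?_
    · rw [sub_sub_sub_cancel_left, abs_sub_comm]
      exact hmean _ (hX.1 i)
    · rw [← hΛ, ← hρ, hr]
      have h1 : Λ * (H * Ch ^ 2) ≤ Λ * (H * Ch ^ 2) * L ^ 2 :=
        le_mul_of_one_le_right (by positivity) hL3
      have h2 : ρ ^ 2 ≤ ρ := by nlinarith
      calc _ = (Λ * (H * Ch ^ 2) + 2 / lam₀ * (Ch * t₂) * L ^ 2) * ρ +
            Λ * (2 * M₁ * d₁ * ρ * L ^ 2 + d₁ ^ 2 * ρ ^ 2 * L ^ 2) := by ring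
        _ ≤ (Λ * (H * Ch ^ 2) * L ^ 2 + 2 / lam₀ * (Ch * t₂) * L ^ 2) * ρ +
            Λ * (2 * M₁ * d₁ * ρ * L ^ 2 + d₁ ^ 2 * ρ * L ^ 2) := by gcongr
        _ = _ := by ring
  have hmem : s ∈ {s | s ∈ HolderClass2 A 0 1 ∧ ∀ x ∈ Icc (0 : ℝ) 1,
      0 ≤ s x ∧ varFloor K X (projBandwidth Ch n hs) a b ≤ s x ^ 2} := by
    refine ⟨hsA, fun x hx => ⟨hsl.le.trans (hs0 x hx), ?_⟩⟩
    exact ((varFloor_le hX hn hn₀ hc₁ hbs hσ).trans hfloor).trans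
      (pow_le_pow_left₀ hsl.le (hs0 x hx) 2)
  have hq : 0 ≤ Real.sqrt (2 / c₁) := Real.sqrt_nonneg _
  have := hest.2.abs_sub_le hmem (r := (r / sl + Real.sqrt (2 / c₁) * (1 + V + r)) * ρ * L ^ 2)
    (by positivity) (fun x hx => ?_) hx
  · refine this.trans (le_of_eq ?_)
    ring
  · refine (hX.abs_sRaw_sub_le hn hn₀ hc₁ hbs hsl (hs0 x hx) (hV x hx) (hvar x hx)).trans ?_
    rw [← hρ]
    calc _ = r * ρ * L ^ 2 / sl + Real.sqrt (2 / c₁) * ((1 + V) * ρ + (r * ρ * L ^ 2) * ρ) := by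
          ring
      _ ≤ r * ρ * L ^ 2 / sl + Real.sqrt (2 / c₁) * ((1 + V) * ρ * L ^ 2 + (r * ρ * L ^ 2) * 1) := by
          have : (1 + V) * ρ ≤ (1 + V) * ρ * L ^ 2 := le_mul_of_one_le_right (by positivity) hL3
          gcongr
      _ = _ := by ring

/-! ### The exceptional event -/

section KernelClass

variable {n n₀ : ℕ} {K : ℝ → ℝ} {X : Fin n → ℝ} {Ch lam₀ a₀ c₁ c₂ K₀ CK VK : ℝ} {k : ℕ}
  {f : ℝ → ℝ}

theorem RegularKernel.abs_le_of_mem_kernelClass (hK : RegularKernel K Ch K₀ CK VK)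
    (hf : f ∈ kernelClass K Ch n k) (y : ℝ) : |f y| ≤ K₀ := by
  obtain ⟨x, -, h, -, rfl⟩ := hf
  simp only
  by_cases hz : (y - x) / h ∈ Icc (-1 : ℝ) 1
  · rw [abs_mul, abs_pow]
    calc _ ≤ 1 * K₀ := mul_le_mul (pow_le_one₀ (abs_nonneg _) (abs_le.2 hz)) (hK.2.1 _)
          (abs_nonneg _) zero_le_one
      _ = K₀ := one_mul _
  · rw [hK.1 _ hz, mul_zero, abs_zero]
    exact (abs_nonneg _).trans (hK.2.1 0)

theorem RegularDesign.sum_sq_le_of_mem_kernelClass (hX : RegularDesign K Ch n₀ lam₀ a₀ c₁ c₂ X)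
    (hK : RegularKernel K Ch K₀ CK VK) (hn : 0 < n) (ha₀ : 0 < a₀)
    (hf : f ∈ kernelClass K Ch n k) :
    ∑ i, f (X i) ^ 2 ≤ 2 * K₀ ^ 2 * a₀ * Ch * (n : ℝ) ^ (4 / 5 : ℝ) := by
  have hb := hK.abs_le_of_mem_kernelClass hf
  obtain ⟨x, -, h, hh, rfl⟩ := hf
  have hh0 := pos_of_mem_bandwidthSet hn hh
  refine (sum_le_of_local (x := x) hn ha₀ hh0 (one_div_le_of_mem_bandwidthSet hh) hX.1 hX.2.2.1
    (sq_nonneg K₀) (fun i => ?_) fun i hi => ?_).trans ?_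
  · rw [← sq_abs]
    exact pow_le_pow_left₀ (abs_nonneg _) (hb _) 2
  · simp only
    rw [kernel_eq_zero_of_lt hK.1 hh0 hi, mul_zero, zero_pow two_ne_zero]
  · calc _ ≤ K₀ ^ 2 * (2 * a₀ * (Ch * (n : ℝ) ^ (4 / 5 : ℝ))) := by
          refine mul_le_mul_of_nonneg_left (mul_le_mul_of_nonneg_left ?_ (by positivity))
            (by positivity)
          exact natCast_mul_le_of_mem_bandwidthSet hn hh
      _ = _ := by ring

end KernelClass

/-- The constant in the bound for the kernel sums of `φ(εᵢ) - E φ(εᵢ)` when, on the truncation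
event, `φ(εᵢ)` is bounded by `m` up to logarithms, and its second moment by `D`. The three terms are
due to Hoeffding's inequality, the approximation by a net, and the truncation. -/
noncomputable def kernelSumFactor (K₀ a₀ Ch VK D m : ℝ) : ℝ :=
  m * Real.sqrt (2 * (2 * K₀ ^ 2 * a₀ * Ch) * (2 * VK + 13)) + 4 * m + K₀ * (D + 1)

/-- Up to an event of probability of order `n⁻¹³`, all kernel sums of `φ(εᵢ) - E φ(εᵢ)` are of order
`n^{2/5}` up to logarithms. -/
theorem RegularDesign.measure_exists_kernel_sum_gt_le {Ω : Type*} [MeasurableSpace Ω]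
    {P : Measure Ω} [IsProbabilityMeasure P] {n n₀ : ℕ} {K : ℝ → ℝ} {X : Fin n → ℝ}
    {Ch lam₀ a₀ c₁ c₂ K₀ CK VK : ℝ} (hX : RegularDesign K Ch n₀ lam₀ a₀ c₁ c₂ X)
    (hK : RegularKernel K Ch K₀ CK VK) (hn : 3 ≤ n) (hCh : 1 < Ch) (ha₀ : 0 < a₀)
    (hK₀ : 0 < K₀) (hCK : 0 < CK) (hVK : 0 < VK) {ε : Fin n → Ω → ℝ}
    (hm : ∀ i, Measurable (ε i)) (hind : iIndepFun ε P) {φ : ℝ → ℝ} (hφ : Measurable φ)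
    {M m β B D : ℝ} (hm0 : 0 < m) (hβ : 0 < β) (hφM : ∀ y, |y| ≤ M → |φ y| ≤ m * β)
    (hD0 : 0 ≤ D) (hβB : β * Real.sqrt (Real.log n) ≤ B) (hβB' : β ≤ B) (hB : 1 ≤ B)
    (hL2 : ∀ i, MemLp (fun ω => φ (ε i ω)) 2 P)
    (hD : ∀ i, ∫ ω, φ (ε i ω) ^ 2 ∂P ≤ D)
    (htail : ∀ i, P.real {ω | M < |ε i ω|} ≤ 1 / (n : ℝ) ^ 2) {k : ℕ} (hk : k = 1 ∨ k = 2) :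
    P {ω | (∀ i, |ε i ω| ≤ M) ∧ ∃ f ∈ kernelClass K Ch n k,
        kernelSumFactor K₀ a₀ Ch VK D m * B * (n : ℝ) ^ (2 / 5 : ℝ) <
          |∑ i, f (X i) * (φ (ε i ω) - ∫ ω, φ (ε i ω) ∂P)|} ≤
      ENNReal.ofReal (2 * CK / (n : ℝ) ^ 13) := by
  have hn0 : 0 < n := by lia
  have hn' : (0 : ℝ) < n := by exact_mod_cast hn0
  have hn1 : (1 : ℝ) ≤ n := by exact_mod_cast hn0
  have hC : 0 < Ch := by linarith
  have hlog : 0 < Real.log n := Real.log_pos (by exact_mod_cast (by lia : 1 < n))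
  obtain ⟨T, hTc, hTF, hT⟩ := exists_kernelClass_net hn0 X hCK hK hk
  set S₁ := 2 * K₀ ^ 2 * a₀ * Ch with hS₁
  have hS₁0 : 0 < S₁ := by positivity
  set Q := 2 * VK + 13 with hQ
  have hQ0 : 0 < Q := by positivity
  set N := (n : ℝ) ^ (2 / 5 : ℝ) with hN
  have hN1 : 1 ≤ N := Real.one_le_rpow hn1 (by norm_num)
  have hNN : (n : ℝ) ^ (4 / 5 : ℝ) = N ^ 2 := by
    rw [hN, ← Real.rpow_natCast, ← Real.rpow_mul hn'.le]
    norm_num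
  have hS : 0 < S₁ * (n : ℝ) ^ (4 / 5 : ℝ) := by positivity
  -- the deviation for which Hoeffding's inequality gives the probability `n ^ (-Q)`
  set u := m * β * (Real.sqrt (2 * S₁ * Q) * Real.sqrt (Real.log n)) * N with hu
  have hu0 : 0 ≤ u := by positivity
  have hmain := measure_exists_weighted_sum_gt_le hn0 hm hind hφ (mul_pos hm0 hβ) hS hu0 hφM hL2
    hD htail (X := X) hTF hT (fun f hf => hX.sum_sq_le_of_mem_kernelClass hK hn0 ha₀ hf)
    (fun f hf => hK.abs_le_of_mem_kernelClass hf)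
  refine (measure_mono ?_).trans (hmain.trans (ENNReal.ofReal_le_ofReal ?_))
  · rintro ω ⟨h1, f, hf, hlt⟩
    refine ⟨h1, f, hf, lt_of_le_of_lt ?_ hlt⟩
    have h2 : u ≤ m * Real.sqrt (2 * S₁ * Q) * B * N := by
      calc u = m * Real.sqrt (2 * S₁ * Q) * (β * Real.sqrt (Real.log n)) * N := by
            rw [hu]
            ring
        _ ≤ _ := by gcongr
    have h3 : 4 * (m * β) ≤ 4 * m * B * N := by
      calc 4 * (m * β) = 4 * m * β := by ring
        _ ≤ 4 * m * B := by gcongr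
        _ ≤ _ := le_mul_of_one_le_right (by positivity) hN1
    have h4 : K₀ * (D + 1) ≤ K₀ * (D + 1) * B * N := by
      rw [mul_assoc _ B]
      exact le_mul_of_one_le_right (by positivity) (one_le_mul_of_one_le_of_one_le hB hN1)
    calc _ ≤ m * Real.sqrt (2 * S₁ * Q) * B * N + 4 * m * B * N + K₀ * (D + 1) * B * N :=
          add_le_add (add_le_add h2 h3) h4
      _ = _ := by
          rw [kernelSumFactor]
          ring
  · have hexp : -u ^ 2 / (2 * ((m * β) ^ 2 * (S₁ * (n : ℝ) ^ (4 / 5 : ℝ)))) =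
        -(Real.log n * Q) := by
      rw [hu, hNN, mul_pow, mul_pow, mul_pow _ (Real.sqrt _), Real.sq_sqrt (by positivity),
        Real.sq_sqrt hlog.le]
      field_simp
    rw [hexp, Real.exp_neg, Real.exp_mul, Real.exp_log hn']
    have hpow : (n : ℝ) ^ Q = ((n : ℝ) ^ 2) ^ VK * (n : ℝ) ^ 13 := by
      rw [hQ, Real.rpow_add hn', Real.rpow_mul hn'.le]
      norm_cast
    rw [hpow]
    calc _ ≤ CK * ((n : ℝ) ^ 2) ^ VK * (2 * (((n : ℝ) ^ 2) ^ VK * (n : ℝ) ^ 13)⁻¹) := by gcongr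
      _ = _ := by
          have : 0 < ((n : ℝ) ^ 2) ^ VK := by positivity
          field_simp

/-- The factor of `(log n)^{1/α}` in the bound for the largest of the errors. The number `15` makes
the tail probability of one error of order `n⁻¹⁵`. -/
noncomputable def errorScale (su σu A₀ α : ℝ) : ℝ :=
  su * (Real.exp 1 * (A₀ * 15 ^ (1 / α))) + σu * Real.sqrt 30

/-- A bound for the second and the fourth moments of the errors. -/
noncomputable def errorMoment (su σu A₀ α : ℝ) : ℝ :=
  su ^ 2 + σu ^ 2 + 8 * (su ^ 4 * (A₀ * 4 ^ (1 / α)) ^ 4 + σu ^ 4 * gaussianFourthMoment)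

theorem errorScale_pos {su σu A₀ α : ℝ} (hsu : 0 < su) (hσu : 0 < σu) (hA₀ : 0 < A₀) :
    0 < errorScale su σu A₀ α := by
  unfold errorScale
  positivity

theorem errorMoment_nonneg (su σu A₀ α : ℝ) : 0 ≤ errorMoment su σu A₀ α := by
  have := gaussianFourthMoment_nonneg
  unfold errorMoment
  have h1 : 0 ≤ (A₀ * 4 ^ (1 / α)) ^ 4 := by positivity
  positivity

/-- With probability at least `1 - n⁻¹¹`, the errors and the kernel sums of the errors and of their
squares are bounded, up to logarithms, by constants and by multiples of `n^{2/5}`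
respectively. -/
theorem LocationScaleSample.measure_not_regular_le {Ω : Type*} [MeasurableSpace Ω] {P : Measure Ω}
    [IsProbabilityMeasure P] {n n₀ : ℕ} {K : ℝ → ℝ} {X : Fin n → ℝ}
    {Ch lam₀ a₀ c₁ c₂ K₀ CK VK : ℝ} (hX : RegularDesign K Ch n₀ lam₀ a₀ c₁ c₂ X)
    (hK : RegularKernel K Ch K₀ CK VK) (hn : 7 ≤ n) (hCh : 1 < Ch) (ha₀ : 0 < a₀)
    (hK₀ : 0 < K₀) (hCK : 0 < CK) (hVK : 0 < VK) (hnCK : 3 + 8 * CK ≤ n)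
    {G₀ : Measure ℝ} [IsProbabilityMeasure G₀] {m₀ s₀ : ℝ → ℝ} {σ : Fin n → ℝ}
    {θ Y : Fin n → Ω → ℝ} (hmodel : LocationScaleSample P G₀ m₀ s₀ σ θ Y)
    {su σu A₀ α : ℝ} (hA₀ : 0 < A₀) (hα : 0 < α) (hα2 : α ≤ 2) (hG : MomentControl G₀ A₀ α)
    (hs : ∀ i, 0 < s₀ (σ i)) (hsu : ∀ i, s₀ (σ i) ≤ su) (hσ : ∀ i, 0 < σ i) (hσu : ∀ i, σ i ≤ σu)
    {L M₁ D t₁ t₂ : ℝ} (hL : L = Real.log n ^ (1 / 2 + 1 / α)) (hM₁ : M₁ = errorScale su σu A₀ α)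
    (hD : D = errorMoment su σu A₀ α) (ht₁ : t₁ = kernelSumFactor K₀ a₀ Ch VK D M₁)
    (ht₂ : t₂ = kernelSumFactor K₀ a₀ Ch VK D (M₁ ^ 2)) :
    P {ω | ¬ ((∀ i, |Y i ω - m₀ (σ i)| ≤ M₁ * L) ∧
      (∀ k, k = 1 ∨ k = 2 → ∀ f ∈ kernelClass K Ch n k,
        |∑ i, f (X i) * (Y i ω - m₀ (σ i))| ≤ t₁ * L * (n : ℝ) ^ (2 / 5 : ℝ)) ∧
      (∀ k, k = 1 ∨ k = 2 → ∀ f ∈ kernelClass K Ch n k,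
        |∑ i, f (X i) * ((Y i ω - m₀ (σ i)) ^ 2 - (s₀ (σ i) ^ 2 + σ i ^ 2))| ≤
          t₂ * L ^ 2 * (n : ℝ) ^ (2 / 5 : ℝ)))} ≤
      ENNReal.ofReal (1 / (n : ℝ) ^ 11) := by
  obtain ⟨hθm, hYm, hindep, hlaw⟩ := hmodel
  have hn0 : 0 < n := by lia
  have hn' : (0 : ℝ) < n := by exact_mod_cast hn0
  have hn7 : (7 : ℝ) ≤ n := by exact_mod_cast hn
  have hsu0 : 0 < su := (hs ⟨0, hn0⟩).trans_le (hsu _)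
  have hσu0 : 0 < σu := (hσ ⟨0, hn0⟩).trans_le (hσu _)
  have hM₁0 : 0 < M₁ := hM₁ ▸ errorScale_pos hsu0 hσu0 hA₀
  have hD0 : 0 ≤ D := hD ▸ errorMoment_nonneg su σu A₀ α
  set l := Real.log n with hl
  have hl1 : 1 ≤ l := by
    rw [hl, Real.le_log_iff_exp_le hn']
    linarith [Real.exp_one_lt_d9]
  have hl0 : 0 < l := by linarith
  have hα1 : 1 / 2 ≤ 1 / α := one_div_le_one_div_of_le hα hα2
  have hsqrt : Real.sqrt l ≤ l ^ (1 / α) := by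
    rw [Real.sqrt_eq_rpow]
    exact Real.rpow_le_rpow_of_exponent_le hl1 hα1
  set β := l ^ (1 / α) with hβ
  have hβ0 : 0 < β := Real.rpow_pos_of_pos hl0 _
  have hLβ : L = β * Real.sqrt l := by
    rw [hL, Real.sqrt_eq_rpow, ← Real.rpow_add hl0, add_comm]
  have hs1 : 1 ≤ Real.sqrt l := Real.one_le_sqrt.2 hl1
  have hβ1 : 1 ≤ β := hs1.trans hsqrt
  have hβL : β ≤ L := hLβ ▸ le_mul_of_one_le_right hβ0.le hs1
  have hL1 : 1 ≤ L := hβ1.trans hβL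
  set M := M₁ * β with hM
  set ε : Fin n → Ω → ℝ := fun i ω => Y i ω - m₀ (σ i) with hε
  have hεm : ∀ i, Measurable (ε i) := fun i => (hYm i).sub_const _
  have hεind : iIndepFun ε P :=
    hindep.comp (fun i (p : ℝ × ℝ) => p.2 - m₀ (σ i)) fun i => by fun_prop
  have hε4 : ∀ i, MemLp (ε i) 4 P := fun i =>
    memLp_four_error hG (hθm i) (hYm i) (hlaw i).1 (hlaw i).2.2
  have hE1 : ∀ i, ∫ ω, ε i ω ∂P = 0 := fun i =>
    integral_error hG (hθm i) (hYm i) (hlaw i).1 (hlaw i).2.2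
  have hE2 : ∀ i, ∫ ω, ε i ω ^ 2 ∂P = s₀ (σ i) ^ 2 + σ i ^ 2 := fun i =>
    integral_error_sq hG (hθm i) (hYm i) (hlaw i).1 (hlaw i).2.1 (hlaw i).2.2
  have hκ := gaussianFourthMoment_nonneg
  have hs2 : ∀ i, s₀ (σ i) ^ 2 ≤ su ^ 2 := fun i => pow_le_pow_left₀ (hs i).le (hsu i) 2
  have hσ2 : ∀ i, σ i ^ 2 ≤ σu ^ 2 := fun i => pow_le_pow_left₀ (hσ i).le (hσu i) 2
  have hD2 : ∀ i, ∫ ω, ε i ω ^ 2 ∂P ≤ D := by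
    intro i
    rw [hE2, hD, errorMoment]
    have : 0 ≤ 8 * (su ^ 4 * (A₀ * 4 ^ (1 / α)) ^ 4 + σu ^ 4 * gaussianFourthMoment) := by
      positivity
    linarith [hs2 i, hσ2 i]
  have hD4 : ∀ i, ∫ ω, (ε i ω ^ 2) ^ 2 ∂P ≤ D := by
    intro i
    simp only [← pow_mul]
    refine (integral_error_pow_four_le hA₀ hG (hθm i) (hYm i) (hlaw i).1 (hlaw i).2.2).trans ?_
    have h1 : s₀ (σ i) ^ 4 ≤ su ^ 4 := pow_le_pow_left₀ (hs i).le (hsu i) 4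
    have h2 : σ i ^ 4 ≤ σu ^ 4 := pow_le_pow_left₀ (hσ i).le (hσu i) 4
    have h3 : s₀ (σ i) ^ 4 * (A₀ * 4 ^ (1 / α)) ^ 4 ≤ su ^ 4 * (A₀ * 4 ^ (1 / α)) ^ 4 := by gcongr
    have h4 : σ i ^ 4 * gaussianFourthMoment ≤ σu ^ 4 * gaussianFourthMoment := by gcongr
    rw [hD, errorMoment]
    nlinarith [sq_nonneg su, sq_nonneg σu]
  have htail : ∀ i, P {ω | M < |ε i ω|} ≤ ENNReal.ofReal (3 / (n : ℝ) ^ 15) := by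
    intro i
    refine (measure_abs_error_gt_le (p := 15 * l) hA₀ (hs i) (hσ i) hG (hθm i) (hYm i)
      (hlaw i).1 (hlaw i).2.2 (by linarith) ?_).trans (le_of_eq ?_)
    · rw [hM, hM₁, errorScale, add_mul]
      have e1 : (15 * l) ^ (1 / α) = 15 ^ (1 / α) * β := Real.mul_rpow (by norm_num) hl0.le
      have e2 : Real.sqrt (2 * (15 * l)) = Real.sqrt 30 * Real.sqrt l := by
        rw [← Real.sqrt_mul (by norm_num)]
        ring_nf
      rw [e1, e2]
      refine add_le_add ?_ ?_
      · calc _ ≤ su * (Real.exp 1 * (A₀ * (15 ^ (1 / α) * β))) :=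
              mul_le_mul_of_nonneg_right (hsu i) (by positivity)
          _ = _ := by ring
      · rw [mul_assoc σu]
        exact mul_le_mul (hσu i) (by gcongr) (by positivity) hσu0.le
    · congr 1
      rw [show -(15 * l) = l * -15 by ring, Real.exp_mul, hl, Real.exp_log hn',
        show (-15 : ℝ) = -((15 : ℕ) : ℝ) by norm_num, Real.rpow_neg hn'.le, Real.rpow_natCast]
      rfl
  have htail' : ∀ i, P.real {ω | M < |ε i ω|} ≤ 1 / (n : ℝ) ^ 2 := by
    intro i
    refine ENNReal.toReal_le_of_le_ofReal (by positivity) ((htail i).trans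
      (ENNReal.ofReal_le_ofReal ?_))
    rw [div_le_div_iff₀ (by positivity) (by positivity)]
    have : (7 : ℝ) ^ 13 ≤ (n : ℝ) ^ 13 := pow_le_pow_left₀ (by norm_num) hn7 13
    have e : (n : ℝ) ^ 15 = (n : ℝ) ^ 13 * (n : ℝ) ^ 2 := by ring
    rw [e, one_mul]
    gcongr
    linarith
  have hsum1 := fun k (hk : k = 1 ∨ k = 2) => hX.measure_exists_kernel_sum_gt_le (φ := fun y => y)
    (M := M) (m := M₁) (β := β) (B := L) (D := D) hK (by lia) hCh ha₀ hK₀ hCK hVK hεm hεind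
    (by fun_prop) hM₁0 hβ0 (fun y hy => hy) hD0 hLβ.ge hβL hL1
    (fun i => (hε4 i).mono_exponent (by norm_num)) hD2 htail' hk
  have hsum2 := fun k (hk : k = 1 ∨ k = 2) => hX.measure_exists_kernel_sum_gt_le
    (φ := fun y => y ^ 2) (M := M) (m := M₁ ^ 2) (β := β ^ 2) (B := L ^ 2) (D := D) hK (by lia)
    hCh ha₀ hK₀ hCK hVK hεm hεind (by fun_prop) (by positivity) (by positivity)
    (fun y hy => by
      rw [abs_pow, ← mul_pow]
      exact pow_le_pow_left₀ (abs_nonneg _) hy 2) hD0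
    (by
      rw [hLβ, mul_pow]
      gcongr
      rw [sq]
      exact le_mul_of_one_le_left (Real.sqrt_nonneg _) hs1)
    (pow_le_pow_left₀ hβ0.le hβL 2) (one_le_pow₀ hL1)
    (fun i => by
      have := (hε4 i).norm_rpow_div 2
      have e : (4 : ℝ≥0∞) / 2 = 2 := by
        rw [ENNReal.div_eq_inv_mul, show (4 : ℝ≥0∞) = 2 * 2 by norm_num, ← mul_assoc,
          ENNReal.inv_mul_cancel (by norm_num) (by norm_num), one_mul]
      rw [e] at this
      refine this.ae_eq (Filter.Eventually.of_forall fun ω => ?_)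
      simp) hD4 htail' hk
  simp only [hE1, hE2, ← ht₁, ← ht₂, sub_zero] at hsum1 hsum2
  set S1 : ℕ → Set Ω := fun k => {ω | (∀ i, |ε i ω| ≤ M) ∧ ∃ f ∈ kernelClass K Ch n k,
    t₁ * L * (n : ℝ) ^ (2 / 5 : ℝ) < |∑ i, f (X i) * ε i ω|} with hS1
  set S2 : ℕ → Set Ω := fun k => {ω | (∀ i, |ε i ω| ≤ M) ∧ ∃ f ∈ kernelClass K Ch n k,
    t₂ * L ^ 2 * (n : ℝ) ^ (2 / 5 : ℝ) <
      |∑ i, f (X i) * (ε i ω ^ 2 - (s₀ (σ i) ^ 2 + σ i ^ 2))|} with hS2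
  refine (measure_mono (t := (⋃ i, {ω | M < |ε i ω|}) ∪ ((S1 1 ∪ S1 2) ∪ (S2 1 ∪ S2 2))) ?_).trans ?_
  · intro ω hω
    by_contra hc
    simp only [mem_union, mem_iUnion, mem_ofPred_eq, not_or, not_exists, not_lt] at hc
    obtain ⟨hb, ⟨h11, h12⟩, h21, h22⟩ := hc
    refine hω ⟨fun i => (hb i).trans (by rw [hM]; gcongr), ?_, ?_⟩
    · rintro k (rfl | rfl) f hf
      · by_contra hlt
        exact h11 ⟨hb, f, hf, not_le.1 hlt⟩
      · by_contra hlt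
        exact h12 ⟨hb, f, hf, not_le.1 hlt⟩
    · rintro k (rfl | rfl) f hf
      · by_contra hlt
        exact h21 ⟨hb, f, hf, not_le.1 hlt⟩
      · by_contra hlt
        exact h22 ⟨hb, f, hf, not_le.1 hlt⟩
  · have hp0 : 0 ≤ 2 * CK / (n : ℝ) ^ 13 := by positivity
    have h1 : P (⋃ i, {ω | M < |ε i ω|}) ≤ ENNReal.ofReal (n * (3 / (n : ℝ) ^ 15)) := by
      refine (measure_iUnion_fintype_le _ _).trans ((Finset.sum_le_sum fun i _ => htail i).trans ?_)
      rw [Finset.sum_const, Finset.card_univ, Fintype.card_fin, nsmul_eq_mul,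
        ENNReal.ofReal_mul hn'.le, ENNReal.ofReal_natCast]
    have h2 : P ((S1 1 ∪ S1 2) ∪ (S2 1 ∪ S2 2)) ≤ ENNReal.ofReal
        ((2 * CK / (n : ℝ) ^ 13 + 2 * CK / (n : ℝ) ^ 13) +
          (2 * CK / (n : ℝ) ^ 13 + 2 * CK / (n : ℝ) ^ 13)) := by
      rw [ENNReal.ofReal_add (add_nonneg hp0 hp0) (add_nonneg hp0 hp0), ENNReal.ofReal_add hp0 hp0]
      refine (measure_union_le _ _).trans (add_le_add ?_ ?_)
      · exact (measure_union_le _ _).trans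
          (add_le_add (hsum1 1 (Or.inl rfl)) (hsum1 2 (Or.inr rfl)))
      · exact (measure_union_le _ _).trans
          (add_le_add (hsum2 1 (Or.inl rfl)) (hsum2 2 (Or.inr rfl)))
    refine (measure_union_le _ _).trans ((add_le_add h1 h2).trans ?_)
    rw [← ENNReal.ofReal_add (by positivity) (by positivity)]
    refine ENNReal.ofReal_le_ofReal ?_
    have e : n * (3 / (n : ℝ) ^ 15) + ((2 * CK / (n : ℝ) ^ 13 + 2 * CK / (n : ℝ) ^ 13) +
        (2 * CK / (n : ℝ) ^ 13 + 2 * CK / (n : ℝ) ^ 13)) =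
        (3 + 8 * CK * n) / (n : ℝ) ^ 14 := by
      field_simp
      ring
    rw [e, div_le_div_iff₀ (by positivity) (by positivity)]
    have e2 : (1 : ℝ) * (n : ℝ) ^ 14 = (n : ℝ) ^ 3 * (n : ℝ) ^ 11 := by ring
    rw [e2]
    gcongr
    have hn2 : (n : ℝ) ≤ (n : ℝ) ^ 2 := by nlinarith
    calc 3 + 8 * CK * n ≤ (3 + 8 * CK) * n := by nlinarith
      _ ≤ n * n := by gcongr
      _ = (n : ℝ) ^ 2 := by ring
      _ ≤ (n : ℝ) ^ 3 := pow_le_pow_right₀ (by linarith) (by norm_num)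

/-! ### Deviations, small samples and the lower bound for the scale -/

/-- For functions in `C_A^2([0,1])`, the deviation bound holds trivially unless `n` is large and
`t ≤ n^{2/5}`, provided the constant is large; and for such `t` it follows from a bound that does
not involve `t`. -/
theorem measure_ge_le_of_bounded {Ω : Type*} [MeasurableSpace Ω] {P : Measure Ω} {n N : ℕ}
    (hn : 7 ≤ n) {err : Ω → ℝ≥0∞} {C Amax B t : ℝ} (ht : 1 < t) (hB : 1 ≤ B) (hA : 0 < Amax)
    (hC : Amax * ((N : ℝ) + 1) < C) (hbdd : ∀ᵐ ω ∂P, err ω ≤ ENNReal.ofReal Amax)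
    (hlarge : N ≤ n → P {ω | ¬ err ω ≤ ENNReal.ofReal (C * (n : ℝ) ^ (-(2 / 5) : ℝ) * B)} ≤
      ENNReal.ofReal (1 / (n : ℝ) ^ 11)) :
    P {ω | ENNReal.ofReal (C * t * (n : ℝ) ^ (-(2 / 5) : ℝ) * B) ≤ err ω} ≤
      ENNReal.ofReal (1 / ((n : ℝ) ^ 10 * t ^ 2)) := by
  have hn' : (0 : ℝ) < n := by exact_mod_cast (by lia : 0 < n)
  have hn1 : (1 : ℝ) ≤ n := by exact_mod_cast (by lia : 1 ≤ n)
  have hC0 : 0 < C := lt_trans (by positivity) hC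
  set ρ := (n : ℝ) ^ (-(2 / 5) : ℝ) with hρ
  have hρ0 : 0 < ρ := Real.rpow_pos_of_pos hn' _
  by_cases hsmall : Amax < C * t * ρ * B
  · have : P {ω | ENNReal.ofReal (C * t * ρ * B) ≤ err ω} = 0 := by
      refine measure_eq_zero_iff_ae_notMem.2 ?_
      filter_upwards [hbdd] with ω hω hle
      have := (ENNReal.ofReal_le_ofReal_iff hA.le).1 (hle.trans hω)
      linarith
    rw [this]
    exact zero_le
  push Not at hsmall
  have hinv : ρ * (n : ℝ) ^ (2 / 5 : ℝ) = 1 := by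
    rw [hρ, ← Real.rpow_add hn']
    norm_num
  have hCA : Amax ≤ C := by nlinarith [mul_nonneg hA.le (Nat.cast_nonneg (α := ℝ) N)]
  have hNn : N ≤ n := by
    by_contra hlt
    push Not at hlt
    have h1 : ((n : ℝ) ^ (2 / 5 : ℝ)) ≤ N := by
      calc _ ≤ (n : ℝ) ^ (1 : ℝ) := Real.rpow_le_rpow_of_exponent_le hn1 (by norm_num)
        _ = n := Real.rpow_one _
        _ ≤ N := by exact_mod_cast hlt.le
    have h2 : C * ρ ≤ Amax := by
      refine le_trans ?_ hsmall
      calc C * ρ = C * 1 * ρ * 1 := by ring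
        _ ≤ _ := by gcongr
    have h3 : C ≤ Amax * (n : ℝ) ^ (2 / 5 : ℝ) := by
      calc C = C * ρ * (n : ℝ) ^ (2 / 5 : ℝ) := by rw [mul_assoc, hinv, mul_one]
        _ ≤ _ := by gcongr
    have h4 : Amax * (n : ℝ) ^ (2 / 5 : ℝ) ≤ Amax * N := by gcongr
    linarith
  have htn : t ≤ (n : ℝ) ^ (2 / 5 : ℝ) := by
    have h1 : Amax * t * ρ * 1 ≤ Amax := by
      refine le_trans ?_ hsmall
      gcongr
    have h2 : t * ρ ≤ 1 := by nlinarith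
    calc t = t * ρ * (n : ℝ) ^ (2 / 5 : ℝ) := by rw [mul_assoc, hinv, mul_one]
      _ ≤ 1 * (n : ℝ) ^ (2 / 5 : ℝ) := by gcongr
      _ = _ := one_mul _
  have ht2 : t ^ 2 ≤ n := by
    calc t ^ 2 ≤ ((n : ℝ) ^ (2 / 5 : ℝ)) ^ 2 := pow_le_pow_left₀ (by linarith) htn 2
      _ = (n : ℝ) ^ (4 / 5 : ℝ) := by
          rw [← Real.rpow_natCast, ← Real.rpow_mul hn'.le]
          norm_num
      _ ≤ (n : ℝ) ^ (1 : ℝ) := Real.rpow_le_rpow_of_exponent_le hn1 (by norm_num)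
      _ = n := Real.rpow_one _
  refine (measure_mono fun ω hω hle => ?_).trans ((hlarge hNn).trans (ENNReal.ofReal_le_ofReal ?_))
  · have h1 := (ENNReal.ofReal_le_ofReal_iff (by positivity)).1
      ((show ENNReal.ofReal (C * t * ρ * B) ≤ err ω from hω).trans hle)
    have h2 : 0 < C * ρ * B := by positivity
    nlinarith
  · refine one_div_le_one_div_of_le (by positivity) ?_
    rw [pow_succ (n : ℝ) 10]
    gcongr

theorem supDist_le_of_holderClass2 {A B : ℝ} (hA : 0 ≤ A) {f g : ℝ → ℝ}
    (hf : f ∈ HolderClass2 A 0 1) (hg : ∀ x ∈ Icc (0 : ℝ) 1, |g x| ≤ B) :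
    supDist f g ≤ ENNReal.ofReal (A + B) :=
  supDist_le_ofReal fun x hx => (abs_sub _ _).trans
    (add_le_add (HolderClass2.abs_le one_pos hA hf hx) (hg x hx))

/-- The scale estimate is bounded away from zero because of the constraint in its projection. -/
theorem IsLLREstimate.le_scale {n : ℕ} (hn : 0 < n) {K : ℝ → ℝ} {Ch A a b σl : ℝ} {X y : Fin n → ℝ}
    {hm hs : ℝ} {mHat sHat : ℝ → ℝ} (hσl : 0 < σl) (hσ : ∀ i, σl ≤ sigmaFn a b (X i))
    (h : IsLLREstimate K Ch A a b X y hm hs mHat sHat) {x : ℝ} (hx : x ∈ Icc (0 : ℝ) 1) :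
    σl / 2 / n ≤ sHat x := by
  have hn1 : (1 : ℝ) ≤ n := by exact_mod_cast hn
  obtain ⟨h0, h1⟩ := h.2.1.2 x hx
  have h2 := (le_varFloor hn K (projBandwidth Ch n hs) hσl hσ).trans h1
  refine abs_le_of_sq_le_sq' (le_trans ?_ h2) h0 |>.2
  rw [div_pow, div_pow, div_mul_eq_mul_div, div_div, div_le_div_iff₀ (by positivity) (by positivity)]
  have : (n : ℝ) + 2 ≤ 2 * (2 ^ 2 * (n : ℝ) ^ 2) := by nlinarith
  calc σl ^ 2 * ((n : ℝ) + 2) ≤ σl ^ 2 * (2 * (2 ^ 2 * (n : ℝ) ^ 2)) := by gcongr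
    _ = _ := by ring

theorem mainTheorem7 (σl σu : ℝ) (hσl : 0 < σl) (hσu : σl < σu) :
    -- the ratio of `A₃` to `A₁` depends on the bounds for the standard errors only
    ∃ c₃ : ℝ, 0 < c₃ ∧
    ∀ sl su A₀ A₁ A₃ α : ℝ, 0 < sl → sl < su → 0 < A₀ → 0 < A₁ → c₃ * A₁ ≤ A₃ → 0 < α → α ≤ 2 →
    ∀ (K : ℝ → ℝ) (n₀ : ℕ) (Ch lam₀ a₀ K₀ c₁ c₂ CK VK : ℝ),
      1 < Ch → 0 < n₀ → 0 < lam₀ → 0 < a₀ → 0 < K₀ → 0 < c₁ → 0 < c₂ → 0 < CK → 0 < VK →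
      RegularKernel K Ch K₀ CK VK →
    ∃ C c : ℝ, 0 < C ∧ 0 < c ∧
    ∀ n : ℕ, 7 ≤ n →
    -- the regressor and the design points
    ∀ (a b : ℝ) (X : Fin n → ℝ), 0 < b →
      (∀ x ∈ Icc (0 : ℝ) 1, sigmaFn a b x ∈ Icc σl σu) →
      (∀ i, sigmaFn a b (X i) ∈ Ioo σl σu) →
      RegularDesign K Ch n₀ lam₀ a₀ c₁ c₂ X →
    -- the distribution of the parameters
    ∀ (m₀ s₀ : ℝ → ℝ) (G₀ : Measure ℝ), IsProbabilityMeasure G₀ →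
      m₀ ∈ HolderClass2 A₁ σl σu → s₀ ∈ HolderClass2 A₁ σl σu →
      (∀ y ∈ Icc σl σu, s₀ y ∈ Ioo sl su) →
      MomentControl G₀ A₀ α →
    -- the data
    ∀ (Ω : Type*) (_ : MeasurableSpace Ω) (P : Measure Ω) (_ : IsProbabilityMeasure P)
      (θ Y : Fin n → Ω → ℝ),
      LocationScaleSample P G₀ m₀ s₀ (fun i => sigmaFn a b (X i)) θ Y →
    -- the data-driven bandwidths and the estimators
    ∀ (hm hs : Ω → ℝ) (mHat sHat : Ω → ℝ → ℝ),
      (∀ᵐ ω ∂P, IsLLREstimate K Ch A₃ a b X (fun i => Y i ω) (hm ω) (hs ω) (mHat ω) (sHat ω)) →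
      (∀ᵐ ω ∂P, mHat ω ∈ HolderClass2 A₃ 0 1 ∧ sHat ω ∈ HolderClass2 A₃ 0 1) ∧
      (∀ t : ℝ, 1 < t →
        P {ω | ENNReal.ofReal
              (C * t * (n : ℝ) ^ (-(2 / 5) : ℝ) * Real.log n ^ (1 + 2 / α)) ≤
            max (supDist (mHat ω) (fun x => m₀ (sigmaFn a b x)))
              (supDist (sHat ω) (fun x => s₀ (sigmaFn a b x)))} ≤
          ENNReal.ofReal (1 / ((n : ℝ) ^ 10 * t ^ 2))) ∧
      (∀ᵐ ω ∂P, ∀ x ∈ Icc (0 : ℝ) 1, c / n ≤ sHat ω x) := by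
  have hσu0 : 0 < σu := hσl.trans hσu
  have hfac := one_le_holderFactor hσl hσu
  refine ⟨holderFactor σl σu, by linarith, ?_⟩
  intro sl su A₀ A₁ A₃ α hsl hslu hA₀ hA₁ hA₃ hα hα2 K n₀ Ch lam₀ a₀ K₀ c₁ c₂ CK VK hCh hn₀ hlam
    ha₀ hK₀ hc₁ hc₂ hCK hVK hK
  have hsu : 0 < su := hsl.trans hslu
  have hA₃0 : 0 < A₃ := lt_of_lt_of_le (by positivity) hA₃
  have hC0 : 0 < Ch := by linarith
  obtain ⟨M₁, hM₁⟩ : ∃ z, z = errorScale su σu A₀ α := ⟨_, rfl⟩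
  obtain ⟨D, hD⟩ : ∃ z, z = errorMoment su σu A₀ α := ⟨_, rfl⟩
  obtain ⟨t₁, ht₁⟩ : ∃ z, z = kernelSumFactor K₀ a₀ Ch VK D M₁ := ⟨_, rfl⟩
  obtain ⟨t₂, ht₂⟩ : ∃ z, z = kernelSumFactor K₀ a₀ Ch VK D (M₁ ^ 2) := ⟨_, rfl⟩
  obtain ⟨Aσ, hAσ⟩ : ∃ z, z = holderFactor σl σu * max σu 1 := ⟨_, rfl⟩
  obtain ⟨H, hH⟩ : ∃ z, z = 3 * A₃ ^ 2 + 3 * Aσ ^ 2 := ⟨_, rfl⟩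
  obtain ⟨V, hV⟩ : ∃ z, z = A₃ ^ 2 + σu ^ 2 := ⟨_, rfl⟩
  obtain ⟨Λ, hΛ⟩ : ∃ z, z = 4 * a₀ * K₀ / lam₀ := ⟨_, rfl⟩
  obtain ⟨d₁, hd₁⟩ : ∃ z, z = 2 * (Λ * (A₃ * Ch ^ 2) + 2 / lam₀ * (Ch * t₁)) := ⟨_, rfl⟩
  obtain ⟨r, hr⟩ : ∃ z, z = Λ * (H * Ch ^ 2) + 2 / lam₀ * (Ch * t₂) + Λ * (2 * M₁ * d₁ + d₁ ^ 2) := ⟨_, rfl⟩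
  obtain ⟨cs, hcs⟩ : ∃ z, z = 2 * (r / sl + Real.sqrt (2 / c₁) * (1 + V + r)) := ⟨_, rfl⟩
  have hM₁0 : 0 < M₁ := hM₁ ▸ errorScale_pos hsu hσu0 hA₀
  have hD0 : 0 ≤ D := hD ▸ errorMoment_nonneg _ _ _ _
  have ht₁0 : 0 ≤ t₁ := by
    rw [ht₁, kernelSumFactor]
    positivity
  have ht₂0 : 0 ≤ t₂ := by
    rw [ht₂, kernelSumFactor]
    positivity
  have hAσ0 : 0 ≤ Aσ := by rw [hAσ]; positivity
  have hH0 : 0 ≤ H := by rw [hH]; positivity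
  have hV0 : 0 ≤ V := by rw [hV]; positivity
  have hΛ0 : 0 ≤ Λ := by rw [hΛ]; positivity
  have hd₁0 : 0 ≤ d₁ := by rw [hd₁]; positivity
  have hr0 : 0 ≤ r := by rw [hr]; positivity
  have hcs0 : 0 ≤ cs := by rw [hcs]; positivity
  -- sample sizes from which on all requirements of the large sample analysis are met
  have hpow : Filter.Tendsto (fun n : ℕ => (n : ℝ) ^ (4 / 5 : ℝ)) Filter.atTop Filter.atTop :=
    (tendsto_rpow_atTop (by norm_num)).comp tendsto_natCast_atTop_atTop
  obtain ⟨N, hN⟩ := Filter.eventually_atTop.1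
    (((Filter.eventually_ge_atTop n₀).and
      (tendsto_natCast_atTop_atTop.eventually_ge_atTop (3 + 8 * CK))).and
      ((hpow.eventually_ge_atTop (Ch / 2)).and
        (hpow.eventually_ge_atTop (2 * σu ^ 2 / (c₁ * sl ^ 2)))))
  refine ⟨d₁ + cs + (A₃ + A₁) * (N + 1) + 1, σl / 2, by positivity, by positivity, ?_⟩
  intro n hn a b X hb hσ hσX hX m₀ s₀ G₀ hGp hm₀ hs₀ hs₀' hG Ω _ P hP θ Y hmodel hm hs mHat sHat
    hest
  have hn0 : 0 < n := by lia
  have hn' : (0 : ℝ) < n := by exact_mod_cast hn0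
  refine ⟨hest.mono fun ω hω => ⟨hω.1.1, hω.2.1.1⟩, fun t ht => ?_, hest.mono fun ω hω x hx =>
    hω.le_scale hn0 hσl (fun i => (hσX i).1.le) hx⟩
  have hl1 : 1 ≤ Real.log n := by
    rw [Real.le_log_iff_exp_le hn']
    have : (7 : ℝ) ≤ n := by exact_mod_cast hn
    linarith [Real.exp_one_lt_d9]
  have hl0 : 0 < Real.log n := by linarith
  have hμ : (fun x => m₀ (sigmaFn a b x)) ∈ HolderClass2 A₃ 0 1 :=
    HolderClass2.mono hA₃ (HolderClass2.comp_sigmaFn hσl hσu hb hσ hA₁.le hm₀)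
  have hsA : (fun x => s₀ (sigmaFn a b x)) ∈ HolderClass2 A₃ 0 1 :=
    HolderClass2.mono hA₃ (HolderClass2.comp_sigmaFn hσl hσu hb hσ hA₁.le hs₀)
  have hσA : sigmaFn a b ∈ HolderClass2 Aσ 0 1 :=
    hAσ ▸ HolderClass2.comp_sigmaFn hσl hσu hb hσ (by positivity) (id_mem_holderClass2 hσl)
  refine measure_ge_le_of_bounded (N := N) hn ht (Real.one_le_rpow hl1 (by positivity))
    (add_pos hA₃0 hA₁) (by linarith) ?_ fun hNn => ?_
  · filter_upwards [hest] with ω hω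
    exact max_le
      (supDist_le_of_holderClass2 hA₃0.le hω.1.1 fun x hx =>
        HolderClass2.abs_le hσu hA₁.le hm₀ (hσ x hx))
      (supDist_le_of_holderClass2 hA₃0.le hω.2.1.1 fun x hx =>
        HolderClass2.abs_le hσu hA₁.le hs₀ (hσ x hx))
  obtain ⟨⟨hnn₀, hnCK⟩, hlarge, hfloor⟩ := hN n hNn
  have hfloor' : 2 * σu ^ 2 / (c₁ * (n : ℝ) ^ (4 / 5 : ℝ)) ≤ sl ^ 2 := by
    rw [div_le_iff₀ (by positivity)] at hfloor ⊢
    linarith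
  have hgood := hmodel.measure_not_regular_le hX hK hn hCh ha₀ hK₀ hCK hVK hnCK hA₀ hα hα2 hG
    (fun i => hsl.trans (hs₀' _ (hσ _ (hX.1 i))).1) (fun i => (hs₀' _ (hσ _ (hX.1 i))).2.le)
    (fun i => sigmaFn_pos _ _ _) (fun i => (hσX i).2.le) rfl hM₁ hD ht₁ ht₂
  refine (measure_mono_ae ?_).trans hgood
  filter_upwards [hest] with ω hω hbad hreg
  obtain ⟨hε, hξ₁, hξ₂⟩ := hreg
  set L := Real.log n ^ (1 / 2 + 1 / α) with hL
  have hL1 : 1 ≤ L := Real.one_le_rpow hl1 (by positivity)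
  have hL2 : L ^ 2 = Real.log n ^ (1 + 2 / α) := by
    rw [hL, ← Real.rpow_natCast, ← Real.rpow_mul hl0.le]
    congr 1
    push_cast
    ring
  have hLL : L ≤ L ^ 2 := le_self_pow₀ hL1 two_ne_zero
  have hvar : ∀ x ∈ Icc (0 : ℝ) 1, ∃ d : ℝ, ∀ y ∈ Icc (0 : ℝ) 1,
      |(s₀ (sigmaFn a b y) ^ 2 + sigmaFn a b y ^ 2) -
        (s₀ (sigmaFn a b x) ^ 2 + sigmaFn a b x ^ 2) - d * (y - x)| ≤ H * (y - x) ^ 2 := by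
    intro x hx
    obtain ⟨d, hd⟩ := HolderClass2.exists_taylor_sq one_pos hA₃0.le hsA x hx
    obtain ⟨e, he⟩ := HolderClass2.exists_taylor_sq one_pos hAσ0 hσA x hx
    refine ⟨d + e, fun y hy => ?_⟩
    have h1 := (abs_add_le _ _).trans (add_le_add (hd y hy) (he y hy))
    refine le_trans (le_of_eq ?_) (h1.trans_eq (by rw [hH]; ring))
    congr 1
    ring
  have key := fun x (hx : x ∈ Icc (0 : ℝ) 1) => hX.estimation_error_le hK hn0 hnn₀ hCh ha₀ hK₀ hlam
    hc₁ hlarge hσ hsl hfloor' hA₃0.le hH0 ht₁0 ht₂0 hM₁0.le hL1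
    (μ := fun x => m₀ (sigmaFn a b x)) (s := fun x => s₀ (sigmaFn a b x)) (V := V) hμ hsA
    (fun x hx => (hs₀' _ (hσ x hx)).1.le) (fun x hx => by
      rw [hV]
      refine add_le_add ?_ (pow_le_pow_left₀ (sigmaFn_pos _ _ _).le (hσ x hx).2 2)
      rw [← sq_abs]
      exact pow_le_pow_left₀ (abs_nonneg _) (HolderClass2.abs_le one_pos hA₃0.le hsA hx) 2)
    hvar hω hε hξ₁ hξ₂ hΛ hd₁ hr hx
  rw [← hL2] at hbad
  refine hbad (max_le (supDist_le_ofReal fun x hx => (key x hx).1.trans ?_)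
    (supDist_le_ofReal fun x hx => (key x hx).2.trans ?_))
  · have : 0 ≤ (A₃ + A₁) * ((N : ℝ) + 1) := by positivity
    gcongr
    linarith
  · have : 0 ≤ (A₃ + A₁) * ((N : ℝ) + 1) := by positivity
    rw [← hcs]
    gcongr
    linarith
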